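/- Let $k\ge 1$ be an integer, $r=k+2$, and let $A=\varepsilon\, i\, e^{\delta\, 2\pi i/4r}$ with signs $\varepsilon,\delta\in\{1,-1\}$ (the four choices of the Kauffman variable at level $k$); put $d=-A^2-A^{-2}$. Let $TL_n(A)$ be the Temperley--Lieb algebra over $\mathbb C$, with generators $u_1,\dots,u_{n-1}$ and relations $u_i^2=d\,u_i$, $u_iu_{i\pm1}u_i=u_i$, and $u_iu_j=u_ju_i$ for $|i-j|\ge2$. Let $TLJ_n(A)$ be its quotient by the two-sided ideal generated by the Jones--Wenzl projector $p_{k+1}$ (so $TLJ_n(A)=TL_n(A)$ if $n\le k$), where $p_1=1$, $p_{m+1}=p_m-\frac{\Delta_{m-1}(d)}{\Delta_m(d)}\,p_mu_mp_m$, $\Delta_0=1$, $\Delta_1=x$, $\Delta_{m+1}=x\Delta_m-\Delta_{m-1}$. The (uncolored) Jones representation at level $k$ is the family of homomorphisms $\rho_{k,n}:B_n\to TLJ_n(A)^\times$, $\sigma_i\mapsto A+A^{-1}u_i$, on the braid groups $B_n$. A family $(\rho_n)$ of representations of the groups $B_n$ on complex vector spaces or in complex algebras is localized by a unitary solution $R\in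 U(W\otimes W)$ of the Yang--Baxter equation $(R\otimes I)(I\otimes R)(R\otimes I)=(I\otimes R)(R\otimes I)(I\otimes R)$, where $W=\mathbb C^m$ for some $m$, if for every $n\ge2$ there is an injective algebra homomorphism $\psi_n:\mathbb C\rho_n(B_n)\to\mathrm{End}(W^{\otimes n})$ with $\psi_n(\rho_n(b))=\rho_R(b)$ for all $b\in B_n$, where $\mathbb C\rho_n(B_n)$ is the algebra generated by the image of $\rho_n$ and $\rho_R(\sigma_i)=I^{\otimes (i-1)}\otimes R\otimes I^{\otimes (n-i-1)}$. It is localizable if it is localized by some such $R$. Then the Jones representation at level $k$ is localizable if and only if $k\in\{1,2,4\}$. Moreover, it is localized, up to multiplying $R$ by a scalar, by the following explicit unitary matrices (in the lexicographically ordered basis of $W\otimes W$). For $k=2$, $W=\mathbb C^2$: $$R=\frac{-e^{-\pi i/4}}{\sqrt2}\begin{pmatrix}1&0&0&1\\0&1&-1&0\\0&1&1&0\\-1&0&0&1\end{pmatrix}.$$ For $k=4$, $W=\mathbb C^3$: the following matrix $R$ (with $\omega=e^{2\pi i/3}$) if $\delta=1$, and its inverse $R^{-1}=R^\dagger$ if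 $\delta=-1$: $$R=\frac{i}{\sqrt3}\begin{pmatrix}\omega&0&0&0&1&0&0&0&\omega\\0&\omega&0&0&0&\omega&1&0&0\\0&0&\omega&\omega^2&0&0&0&\omega^2&0\\0&0&\omega^2&\omega&0&0&0&\omega^2&0\\\omega&0&0&0&\omega&0&0&0&1\\0&1&0&0&0&\omega&\omega&0&0\\0&\omega&0&0&0&1&\omega&0&0\\0&0&\omega^2&\omega^2&0&0&0&\omega&0\\1&0&0&0&\omega&0&0&0&\omega\end{pmatrix}.$$ -/

import Mathlib

open scoped Matrix

/-! ### The braid group -/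

/-- The Artin relations among the generators `σ_0, …, σ_{n-2}`. -/
inductive ArtinRel (n : ℕ) : FreeGroup (Fin (n - 1)) → Prop
  | far (i j : Fin (n - 1)) (h : i.val + 2 ≤ j.val) :
      ArtinRel n (FreeGroup.of i * FreeGroup.of j * (FreeGroup.of j * FreeGroup.of i)⁻¹)
  | braid (i j : Fin (n - 1)) (h : j.val = i.val + 1) :
      ArtinRel n (FreeGroup.of i * FreeGroup.of j * FreeGroup.of i *
        (FreeGroup.of j * FreeGroup.of i * FreeGroup.of j)⁻¹)

/-- The braid group on `n` strands, in Artin's presentation (generators indexed from `0`). -/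
abbrev BraidGroup (n : ℕ) : Type := PresentedGroup {w | ArtinRel n w}

/-- The `i`-th Artin generator. -/
def BraidGroup.σ {n : ℕ} (i : Fin (n - 1)) : BraidGroup n := PresentedGroup.of i

/-- A family of group elements satisfying the Artin relations gives a homomorphism. -/
def BraidGroup.lift {n : ℕ} {G : Type*} [Group G] (s : Fin (n - 1) → G)
    (far : ∀ i j : Fin (n - 1), i.val + 2 ≤ j.val → s i * s j = s j * s i)
    (braid : ∀ i j : Fin (n - 1), j.val = i.val + 1 → s i * s j * s i = s j * s i * s j) :
    BraidGroup n →* G :=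
  PresentedGroup.toGroup (f := s) (by
    rintro w (⟨i, j, h⟩ | ⟨i, j, h⟩)
    · simpa [mul_inv_eq_one, ← mul_assoc] using mul_inv_eq_one.2 (far i j h)
    · simpa [mul_inv_eq_one, ← mul_assoc] using mul_inv_eq_one.2 (braid i j h))

/-! ### Temperley-Lieb and Temperley-Lieb-Jones algebras -/

/-- The loop variable `d = -A² - A⁻²`. -/
noncomputable def loopVar (A : ℂˣ) : ℂ := -(A : ℂ) ^ 2 - ((A⁻¹ : ℂˣ) : ℂ) ^ 2

/-- The Temperley-Lieb relations among `u_0, …, u_{n-2}`. -/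
inductive TLRel (A : ℂˣ) (n : ℕ) :
    FreeAlgebra ℂ (Fin (n - 1)) → FreeAlgebra ℂ (Fin (n - 1)) → Prop
  | sq (i : Fin (n - 1)) :
      TLRel A n (FreeAlgebra.ι ℂ i * FreeAlgebra.ι ℂ i) (loopVar A • FreeAlgebra.ι ℂ i)
  | far (i j : Fin (n - 1)) (h : i.val + 2 ≤ j.val) :
      TLRel A n (FreeAlgebra.ι ℂ i * FreeAlgebra.ι ℂ j) (FreeAlgebra.ι ℂ j * FreeAlgebra.ι ℂ i)
  | adj (i j : Fin (n - 1)) (h : j.val = i.val + 1 ∨ i.val = j.val + 1) :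
      TLRel A n (FreeAlgebra.ι ℂ i * FreeAlgebra.ι ℂ j * FreeAlgebra.ι ℂ i) (FreeAlgebra.ι ℂ i)

/-- The Temperley-Lieb algebra `TL_n(A)` over `ℂ`. -/
def TL (A : ℂˣ) (n : ℕ) : Type := RingQuot (TLRel A n)

noncomputable instance (A : ℂˣ) (n : ℕ) : Ring (TL A n) :=
  inferInstanceAs (Ring (RingQuot (TLRel A n)))

noncomputable instance (A : ℂˣ) (n : ℕ) : Algebra ℂ (TL A n) :=
  inferInstanceAs (Algebra ℂ (RingQuot (TLRel A n)))

/-- The quotient map onto `TL_n(A)`. -/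
noncomputable def TL.mk (A : ℂˣ) (n : ℕ) : FreeAlgebra ℂ (Fin (n - 1)) →ₐ[ℂ] TL A n :=
  RingQuot.mkAlgHom ℂ (TLRel A n)

theorem TL.mk_rel (A : ℂˣ) {n : ℕ} {x y : FreeAlgebra ℂ (Fin (n - 1))} (h : TLRel A n x y) :
    TL.mk A n x = TL.mk A n y :=
  RingQuot.mkAlgHom_rel ℂ h

/-- The generator `u_i` of `TL_n(A)`. -/
noncomputable def TL.u (A : ℂˣ) {n : ℕ} (i : Fin (n - 1)) : TL A n :=
  TL.mk A n (FreeAlgebra.ι ℂ i)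

/-- `Δ_m(d)`, where `Δ_0 = 1`, `Δ_1 = x`, `Δ_{m+2} = x Δ_{m+1} - Δ_m`. -/
noncomputable def chebDelta (A : ℂˣ) (m : ℕ) : ℂ :=
  (Polynomial.Chebyshev.S ℂ (m : ℤ)).eval (loopVar A)

/-- `TL.jonesWenzl A n m` is the Jones-Wenzl projector on the first `m + 1` of `n` strands, i.e.
`p_{m+1} ∈ TL_n(A)`, by the recursion `p_1 = 1`,
`p_{m+2} = p_{m+1} - (Δ_m / Δ_{m+1}) p_{m+1} u_m p_{m+1}` (where `u_m` joins the strands with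
indices `m` and `m + 1`, counted from `0`). It is meaningful when
`Δ_1, …, Δ_m` do not vanish. -/
noncomputable def TL.jonesWenzl (A : ℂˣ) (n : ℕ) : (m : ℕ) → m < n → TL A n
  | 0, _ => 1
  | m + 1, h =>
    let p := TL.jonesWenzl A n m (Nat.lt_of_succ_lt h)
    p - (chebDelta A m / chebDelta A (m + 1)) • (p * TL.u A ⟨m, Nat.lt_sub_of_add_lt h⟩ * p)

/-- The relation `p_{k+1} = 0` in `TL_n(A)` (no relation if `n < k + 1`). -/
inductive TLJRel (k : ℕ) (A : ℂˣ) (n : ℕ) : TL A n → TL A n → Prop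
  | jw (h : k < n) : TLJRel k A n (TL.jonesWenzl A n k h) 0

/-- The Temperley-Lieb-Jones algebra `TLJ_n(A)` at level `k`: the quotient of `TL_n(A)` by the
two-sided ideal generated by the Jones-Wenzl projector `p_{k+1}`. -/
def TLJ (k : ℕ) (A : ℂˣ) (n : ℕ) : Type := RingQuot (TLJRel k A n)

noncomputable instance (k : ℕ) (A : ℂˣ) (n : ℕ) : Ring (TLJ k A n) :=
  inferInstanceAs (Ring (RingQuot (TLJRel k A n)))

noncomputable instance (k : ℕ) (A : ℂˣ) (n : ℕ) : Algebra ℂ (TLJ k A n) :=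
  inferInstanceAs (Algebra ℂ (RingQuot (TLJRel k A n)))

/-- The quotient map from `TL_n(A)` onto `TLJ_n(A)`. -/
noncomputable def TLJ.mk (k : ℕ) (A : ℂˣ) (n : ℕ) : TL A n →ₐ[ℂ] TLJ k A n :=
  RingQuot.mkAlgHom ℂ (TLJRel k A n)

/-- The generator `u_i` of `TLJ_n(A)`. -/
noncomputable def TLJ.u (k : ℕ) (A : ℂˣ) {n : ℕ} (i : Fin (n - 1)) : TLJ k A n :=
  TLJ.mk k A n (TL.u A i)

theorem TLJ.u_sq (k : ℕ) (A : ℂˣ) {n : ℕ} (i : Fin (n - 1)) :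
    TLJ.u k A i * TLJ.u k A i = loopVar A • TLJ.u k A i := by
  have h : TL.u A i * TL.u A i = loopVar A • TL.u A i := by
    simpa [TL.u] using TL.mk_rel A (TLRel.sq (A := A) i)
  simp only [TLJ.u, ← map_mul, h, map_smul]

theorem TLJ.u_far (k : ℕ) (A : ℂˣ) {n : ℕ} (i j : Fin (n - 1)) (hij : i.val + 2 ≤ j.val) :
    TLJ.u k A i * TLJ.u k A j = TLJ.u k A j * TLJ.u k A i := by
  have h : TL.u A i * TL.u A j = TL.u A j * TL.u A i := by
    simpa [TL.u] using TL.mk_rel A (TLRel.far (A := A) i j hij)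
  simp only [TLJ.u, ← map_mul, h]

theorem TLJ.u_adj (k : ℕ) (A : ℂˣ) {n : ℕ} (i j : Fin (n - 1))
    (hij : j.val = i.val + 1 ∨ i.val = j.val + 1) :
    TLJ.u k A i * TLJ.u k A j * TLJ.u k A i = TLJ.u k A i := by
  have h : TL.u A i * TL.u A j * TL.u A i = TL.u A i := by
    simpa [TL.u] using TL.mk_rel A (TLRel.adj (A := A) i j hij)
  simp only [TLJ.u, ← map_mul, h]

/-! ### The Jones representation -/

/-- The Kauffman bracket of a crossing, `A + A⁻¹ u_i`, as a unit of `TLJ_n(A)`; the inverse is the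
opposite crossing `A⁻¹ + A u_i`. -/
noncomputable def kauffmanCrossing (k : ℕ) (A : ℂˣ) {n : ℕ} (i : Fin (n - 1)) : (TLJ k A n)ˣ where
  val := (A : ℂ) • 1 + ((A⁻¹ : ℂˣ) : ℂ) • TLJ.u k A i
  inv := ((A⁻¹ : ℂˣ) : ℂ) • 1 + (A : ℂ) • TLJ.u k A i
  val_inv := by
    have hA : (A : ℂ) ≠ 0 := A.ne_zero
    simp only [mul_add, add_mul, smul_mul_smul_comm, one_mul, mul_one, TLJ.u_sq, smul_smul]
    rw [← sub_eq_zero]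
    have : ∀ x y : TLJ k A n, ∀ a b c e : ℂ, a = 1 → b + c + e = 0 →
        a • x + b • y + (c • y + e • y) - x = 0 := by
      intro x y a b c e ha h
      rw [ha, one_smul, ← add_smul, add_assoc, ← add_smul, ← add_assoc, h, zero_smul, add_zero, sub_self]
    apply this
    · simp
    · simp only [loopVar, Units.val_inv_eq_inv_val]; field_simp; ring
  inv_val := by
    have hA : (A : ℂ) ≠ 0 := A.ne_zero
    simp only [mul_add, add_mul, smul_mul_smul_comm, one_mul, mul_one, TLJ.u_sq, smul_smul]
    rw [← sub_eq_zero]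
    have : ∀ x y : TLJ k A n, ∀ a b c e : ℂ, a = 1 → b + c + e = 0 →
        a • x + b • y + (c • y + e • y) - x = 0 := by
      intro x y a b c e ha h
      rw [ha, one_smul, ← add_smul, add_assoc, ← add_smul, ← add_assoc, h, zero_smul, add_zero, sub_self]
    apply this
    · simp
    · simp only [loopVar, Units.val_inv_eq_inv_val]; field_simp; ring

theorem kauffmanCrossing_far (k : ℕ) (A : ℂˣ) {n : ℕ} (i j : Fin (n - 1))
    (h : i.val + 2 ≤ j.val) :
    kauffmanCrossing k A i * kauffmanCrossing k A j =
      kauffmanCrossing k A j * kauffmanCrossing k A i := by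
  ext
  simp only [kauffmanCrossing, Units.val_mul, mul_add, add_mul, smul_mul_smul_comm, one_mul,
    mul_one, TLJ.u_far k A i j h]
  simp only [mul_comm]
  abel

theorem kauffmanCrossing_braid (k : ℕ) (A : ℂˣ) {n : ℕ} (i j : Fin (n - 1))
    (h : j.val = i.val + 1) :
    kauffmanCrossing k A i * kauffmanCrossing k A j * kauffmanCrossing k A i =
      kauffmanCrossing k A j * kauffmanCrossing k A i * kauffmanCrossing k A j := by
  have hA : (A : ℂ) ≠ 0 := A.ne_zero
  ext
  simp only [kauffmanCrossing, Units.val_mul, mul_add, add_mul, smul_mul_smul_comm, one_mul,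
    mul_one, TLJ.u_sq, TLJ.u_adj k A i j (Or.inl h), TLJ.u_adj k A j i (Or.inr h), smul_smul]
  simp only [loopVar, Units.val_inv_eq_inv_val]
  match_scalars <;> (field_simp; try ring)

/-- The Jones representation `ρ_{k,n}` at level `k` with Kauffman variable `A`, i.e. the Kauffman
bracket `σ_i ↦ A + A⁻¹ u_i` from the braid group to `TLJ_n(A)`. -/
noncomputable def jonesRep (k : ℕ) (A : ℂˣ) (n : ℕ) : BraidGroup n →* TLJ k A n :=
  (Units.coeHom (TLJ k A n)).comp
    (BraidGroup.lift (kauffmanCrossing k A) (kauffmanCrossing_far k A)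
      (kauffmanCrossing_braid k A))

/-- The four unitary choices `A = ± i e^{± 2πi/4r}`, `r = k + 2`, of the Kauffman variable at
level `k`; `ε` is the first sign, `δ` the second. -/
noncomputable def kauffmanVar (k : ℕ) (ε δ : ℤˣ) : ℂˣ :=
  Units.mk0
    (((ε : ℤ) : ℂ) * Complex.I *
      Complex.exp (((δ : ℤ) : ℂ) * (2 * (Real.pi : ℂ) * Complex.I / (4 * ((k : ℂ) + 2)))))
    (mul_ne_zero (mul_ne_zero (Int.cast_ne_zero.2 (Units.ne_zero ε)) Complex.I_ne_zero)
      (Complex.exp_ne_zero _))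

/-! ### Unitary R-matrices and the local braid representations

`(ℂ^d)^{⊗ κ}` has the orthonormal basis `κ → Fin d`, so operators on it are matrices indexed by
`κ → Fin d`. -/

/-- For an injection `s : ι ↪ κ` of sets of tensor factors and an operator `M` on the factors `ι`,
the operator on the factors `κ` that acts as `M` on those in the range of `s` and as the identity
on the others. -/
def promote {ι κ α : Type*} [Fintype ι] [Fintype κ] [DecidableEq κ] [DecidableEq α] (s : ι ↪ κ) (M : Matrix (ι → α) (ι → α) ℂ) : Matrix (κ → α) (κ → α) ℂ :=
  Matrix.of fun f g =>
    if ∀ j, (∀ i, s i ≠ j) → f j = g j then M (fun i => f (s i)) (fun i => g (s i)) else 0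

section promote

variable {ι κ μ α : Type*} [Fintype ι] [Fintype κ] [Fintype μ] [DecidableEq ι] [DecidableEq κ]
  [DecidableEq μ] [DecidableEq α] [Fintype α]

set_option linter.unusedSectionVars false

theorem promote_mul (s : ι ↪ κ) (M N : Matrix (ι → α) (ι → α) ℂ) :
    promote s M * promote s N = promote s (M * N) := by
  ext f h
  simp only [promote, Matrix.mul_apply, Matrix.of_apply]
  by_cases hfh : ∀ j, (∀ i, s i ≠ j) → f j = h j
  · rw [if_pos hfh]
    symm
    refine Finset.sum_of_injOn (fun a => Function.extend s a f) ?_ (by simp) ?_ ?_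
    · intro a _ b _ hab
      funext i
      simpa [s.injective.extend_apply] using congrFun hab (s i)
    · intro g _ hg
      rw [ite_mul, zero_mul]
      refine ite_eq_right_iff.2 fun h1 => (hg ?_).elim
      refine ⟨fun i => g (s i), by simp, ?_⟩
      funext j
      by_cases hj : ∃ i, s i = j
      · obtain ⟨i, rfl⟩ := hj
        simp [s.injective.extend_apply]
      · exact (Function.extend_apply' _ _ _ hj).trans (h1 j (not_exists.1 hj))
    · intro a _
      have hoff : ∀ j, (∀ i, s i ≠ j) → Function.extend s a f j = f j := fun j hj =>
        Function.extend_apply' _ _ _ (not_exists.2 hj)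
      rw [if_pos fun j hj => (hoff j hj).symm, if_pos fun j hj => (hoff j hj).trans (hfh j hj)]
      simp [s.injective.extend_apply]
  · rw [if_neg hfh]
    refine Finset.sum_eq_zero fun g _ => ?_
    by_cases h1 : ∀ j, (∀ i, s i ≠ j) → f j = g j
    · have h2 : ¬ ∀ j, (∀ i, s i ≠ j) → g j = h j :=
        fun h2 => hfh fun j hj => (h1 j hj).trans (h2 j hj)
      simp only [if_neg h2, mul_zero]
    · simp only [if_neg h1, zero_mul]

theorem promote_one (s : ι ↪ κ) : promote s (1 : Matrix (ι → α) (ι → α) ℂ) = 1 := by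
  ext f g
  simp only [promote, Matrix.of_apply, Matrix.one_apply]
  rw [← ite_and]
  congr 1
  refine propext ⟨fun h => funext fun j => ?_, fun h => by simp [h]⟩
  by_cases hj : ∃ i, s i = j
  · obtain ⟨i, rfl⟩ := hj
    exact congrFun h.2 i
  · exact h.1 j (not_exists.1 hj)

theorem promote_star (s : ι ↪ κ) (M : Matrix (ι → α) (ι → α) ℂ) :
    star (promote s M) = promote s (star M) := by
  ext f g
  simp only [promote, Matrix.star_apply, Matrix.of_apply, apply_ite star, star_zero]
  congr 1
  exact propext ⟨fun h j hj => (h j hj).symm, fun h j hj => (h j hj).symm⟩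

theorem promote_promote (s : ι ↪ κ) (t : κ ↪ μ) (M : Matrix (ι → α) (ι → α) ℂ) :
    promote t (promote s M) = promote (s.trans t) M := by
  ext f g
  simp only [promote, Matrix.of_apply, Function.Embedding.trans_apply]
  rw [← ite_and]
  congr 1
  refine propext ⟨fun h j hj => ?_, fun h => ⟨fun j hj => h j fun i => hj _, fun j hj => ?_⟩⟩
  · by_cases hjt : ∃ i, t i = j
    · obtain ⟨i, rfl⟩ := hjt
      exact h.2 i fun i' hi' => hj i' (by rw [hi'])
    · exact h.1 j (not_exists.1 hjt)
  · exact h _ fun i hi => hj i (t.injective hi)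

theorem promote_mul_apply (s : ι ↪ μ) (t : κ ↪ μ) (hst : ∀ i j, s i ≠ t j)
    (M : Matrix (ι → α) (ι → α) ℂ) (N : Matrix (κ → α) (κ → α) ℂ) (f h : μ → α) :
    (promote s M * promote t N) f h =
      if ∀ j, (∀ i, s i ≠ j) → (∀ i, t i ≠ j) → f j = h j then
        M (fun i => f (s i)) (fun i => h (s i)) * N (fun i => f (t i)) (fun i => h (t i))
      else 0 := by
  have hs : ∀ j, (∀ i, s i ≠ j) → Function.extend s (fun i => h (s i)) f j = f j :=
    fun j hj => Function.extend_apply' _ _ _ (not_exists.2 hj)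
  have hs' : ∀ i, Function.extend s (fun i => h (s i)) f (s i) = h (s i) :=
    fun i => s.injective.extend_apply _ _ i
  rw [Matrix.mul_apply, Finset.sum_eq_single (Function.extend s (fun i => h (s i)) f)]
  · simp only [promote, Matrix.of_apply]
    rw [if_pos fun j hj => (hs j hj).symm]
    simp only [hs', fun i => hs (t i) fun i' => hst i' i, mul_ite, mul_zero]
    congr 1
    refine propext ⟨fun H j h1 h2 => (hs j h1).symm.trans (H j h2), fun H j h2 => ?_⟩
    by_cases hj : ∃ i, s i = j
    · obtain ⟨i, rfl⟩ := hj
      exact hs' i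
    · exact (hs j (not_exists.1 hj)).trans (H j (not_exists.1 hj) h2)
  · intro g _ hg
    simp only [promote, Matrix.of_apply]
    by_cases h1 : ∀ j, (∀ i, s i ≠ j) → f j = g j
    · have h2 : ¬ ∀ j, (∀ i, t i ≠ j) → g j = h j := by
        intro h2
        apply hg
        funext j
        by_cases hj : ∃ i, s i = j
        · obtain ⟨i, rfl⟩ := hj
          exact (h2 _ fun i' hi' => hst i i' hi'.symm).trans (hs' i).symm
        · exact (h1 j (not_exists.1 hj)).symm.trans (hs j (not_exists.1 hj)).symm
      simp only [if_neg h2, mul_zero]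
    · simp only [if_neg h1, zero_mul]
  · simp

theorem promote_commute (s : ι ↪ μ) (t : κ ↪ μ) (hst : ∀ i j, s i ≠ t j)
    (M : Matrix (ι → α) (ι → α) ℂ) (N : Matrix (κ → α) (κ → α) ℂ) :
    promote s M * promote t N = promote t N * promote s M := by
  ext f h
  rw [promote_mul_apply s t hst, promote_mul_apply t s fun i j hij => hst j i hij.symm, mul_comm]
  congr 1
  exact propext ⟨fun H j h1 h2 => H j h2 h1, fun H j h1 h2 => H j h2 h1⟩

theorem promote_mem_unitaryGroup (s : ι ↪ κ) {M : Matrix (ι → α) (ι → α) ℂ}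
    (hM : M ∈ Matrix.unitaryGroup (ι → α) ℂ) :
    promote s M ∈ Matrix.unitaryGroup (κ → α) ℂ := by
  rw [Matrix.mem_unitaryGroup_iff] at hM ⊢
  rw [promote_star, promote_mul, hM, promote_one]

end promote

/-- The pair of adjacent tensor factors `i, i + 1` among `n`. -/
def adjacent {n : ℕ} (i : Fin (n - 1)) : Fin 2 ↪ Fin n where
  toFun a := ⟨i.val + a.val, by omega⟩
  inj' a b h := by
    have := congrArg Fin.val h
    simp only at this
    exact Fin.ext (by omega)

/-- A unitary operator `R` on `ℂ^d ⊗ ℂ^d` that solves the Yang-Baxter equation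
`(R ⊗ 1)(1 ⊗ R)(R ⊗ 1) = (1 ⊗ R)(R ⊗ 1)(1 ⊗ R)`: a `d`-dimensional braided vector space with
unitary `R`. The entry of `R` at `(![a, b], ![c, e])` is the coefficient of `e_a ⊗ e_b` in
`R (e_c ⊗ e_e)`. -/
structure UnitaryRMatrix (d : ℕ) where
  R : Matrix (Fin 2 → Fin d) (Fin 2 → Fin d) ℂ
  unitary : R ∈ Matrix.unitaryGroup (Fin 2 → Fin d) ℂ
  yangBaxter :
    promote (adjacent (n := 3) 0) R * promote (adjacent (n := 3) 1) R *
        promote (adjacent (n := 3) 0) R =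
      promote (adjacent (n := 3) 1) R * promote (adjacent (n := 3) 0) R *
        promote (adjacent (n := 3) 1) R

/-- Three consecutive tensor factors `i, i + 1, i + 2` among `n`. -/
def consecutive {n : ℕ} (i : ℕ) (h : i + 2 < n) : Fin 3 ↪ Fin n where
  toFun a := ⟨i + a.val, by omega⟩
  inj' a b h := by
    have := congrArg Fin.val h
    simp only at this
    exact Fin.ext (by omega)

/-- `1^{⊗ i} ⊗ R ⊗ 1^{⊗ (n - i - 2)}` as a unitary operator on `(ℂ^d)^{⊗ n}`. -/
def UnitaryRMatrix.gate {d : ℕ} (W : UnitaryRMatrix d) {n : ℕ} (i : Fin (n - 1)) :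
    Matrix.unitaryGroup (Fin n → Fin d) ℂ :=
  ⟨promote (adjacent i) W.R, promote_mem_unitaryGroup _ W.unitary⟩

theorem UnitaryRMatrix.gate_far {d : ℕ} (W : UnitaryRMatrix d) {n : ℕ} (i j : Fin (n - 1))
    (h : i.val + 2 ≤ j.val) : W.gate i * W.gate j = W.gate j * W.gate i := by
  refine Subtype.ext (promote_commute _ _ (fun a b hab => ?_) _ _)
  have h' : i.val + a.val = j.val + b.val := congrArg Fin.val hab
  omega

theorem UnitaryRMatrix.gate_braid {d : ℕ} (W : UnitaryRMatrix d) {n : ℕ} (i j : Fin (n - 1))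
    (h : j.val = i.val + 1) :
    W.gate i * W.gate j * W.gate i = W.gate j * W.gate i * W.gate j := by
  have hn : i.val + 2 < n := by omega
  have hi : adjacent i = (adjacent (n := 3) 0).trans (consecutive i.val hn) := by
    ext a
    change i.val + a.val = i.val + (0 + a.val)
    omega
  have hj : adjacent j = (adjacent (n := 3) 1).trans (consecutive i.val hn) := by
    ext a
    change j.val + a.val = i.val + (1 + a.val)
    omega
  refine Subtype.ext ?_
  simp only [UnitaryRMatrix.gate, Submonoid.coe_mul]
  rw [hi, hj, ← promote_promote, ← promote_promote, promote_mul, promote_mul, promote_mul,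
    promote_mul, W.yangBaxter]

/-- The braid group representation `ρ_R` on `(ℂ^d)^{⊗ n}`,
`σ_i ↦ 1^{⊗ i} ⊗ R ⊗ 1^{⊗ (n - i - 2)}` (`i` counted from `0`). -/
def UnitaryRMatrix.rep {d : ℕ} (W : UnitaryRMatrix d) (n : ℕ) :
    BraidGroup n →* Matrix.unitaryGroup (Fin n → Fin d) ℂ :=
  BraidGroup.lift W.gate W.gate_far W.gate_braid

/-! ### Localizations -/

/-- The algebra `ℂ ρ(G)` generated by the image of a representation `ρ` (in an algebra `E`, such as
the endomorphism algebra of a vector space). -/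
abbrev imageAlgebra {G E : Type*} [Group G] [Ring E] [Algebra ℂ E] (ρ : G →* E) :
    Subalgebra ℂ E :=
  Algebra.adjoin ℂ (Set.range ρ)

/-- `W` is a localization of the family `ρ_n` of braid group representations: for all `n ≥ 2` there
is an injective algebra homomorphism `ψ_n : ℂ ρ_n(B_n) → End(W^{⊗ n})` with
`ψ_n (ρ_n b) = ρ_R b` for all `b ∈ B_n`. -/
def IsLocalizedBy {E : ℕ → Type*} [∀ n, Ring (E n)] [∀ n, Algebra ℂ (E n)]
    (ρ : ∀ n, BraidGroup n →* E n) {d : ℕ} (W : UnitaryRMatrix d) : Prop :=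
  ∀ n, 2 ≤ n → ∃ ψ : imageAlgebra (ρ n) →ₐ[ℂ] Matrix (Fin n → Fin d) (Fin n → Fin d) ℂ,
    Function.Injective ψ ∧
      ∀ b : BraidGroup n, ψ ⟨ρ n b, Algebra.subset_adjoin ⟨b, rfl⟩⟩ = (W.rep n b).val

/-- The family `ρ_n` of braid group representations has a localization by a (finite-dimensional)
braided vector space with unitary `R`. -/
def Localizable {E : ℕ → Type*} [∀ n, Ring (E n)] [∀ n, Algebra ℂ (E n)]
    (ρ : ∀ n, BraidGroup n →* E n) : Prop :=
  ∃ (d : ℕ) (W : UnitaryRMatrix d), IsLocalizedBy ρ W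

/-! ### Two explicit R-matrices -/

/-- An operator on `ℂ^d ⊗ ℂ^d` from its `d² × d²` matrix in the lexicographically ordered basis
`e_0 ⊗ e_0, e_0 ⊗ e_1, …, e_{d-1} ⊗ e_{d-1}`. -/
def ofLexMatrix {d : ℕ} (M : Matrix (Fin (d * d)) (Fin (d * d)) ℂ) :
    Matrix (Fin 2 → Fin d) (Fin 2 → Fin d) ℂ :=
  Matrix.of fun f g => M (finProdFinEquiv (f 0, f 1)) (finProdFinEquiv (g 0, g 1))

/-- The explicit `4 × 4` matrix. -/
noncomputable def isingR : Matrix (Fin 2 → Fin 2) (Fin 2 → Fin 2) ℂ :=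
  ofLexMatrix <| (-Complex.exp (-((Real.pi : ℂ) * Complex.I / 4)) / (Real.sqrt 2 : ℂ)) •
    (!![1, 0, 0, 1;
        0, 1, -1, 0;
        0, 1, 1, 0;
        -1, 0, 0, 1] : Matrix (Fin 4) (Fin 4) ℂ)

/-- `ω = e^{2πi/3}`. -/
noncomputable def cubeRoot : ℂ := Complex.exp (2 * (Real.pi : ℂ) * Complex.I / 3)

/-- The explicit `9 × 9` matrix. -/
noncomputable def levelFourR : Matrix (Fin 2 → Fin 3) (Fin 2 → Fin 3) ℂ :=
  let w := cubeRoot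
  ofLexMatrix <| (Complex.I / (Real.sqrt 3 : ℂ)) •
    (!![w, 0, 0, 0, 1, 0, 0, 0, w;
        0, w, 0, 0, 0, w, 1, 0, 0;
        0, 0, w, w ^ 2, 0, 0, 0, w ^ 2, 0;
        0, 0, w ^ 2, w, 0, 0, 0, w ^ 2, 0;
        w, 0, 0, 0, w, 0, 0, 0, 1;
        0, 1, 0, 0, 0, w, w, 0, 0;
        0, w, 0, 0, 0, 1, w, 0, 0;
        0, 0, w ^ 2, w ^ 2, 0, 0, 0, w, 0;
        1, 0, 0, 0, w, 0, 0, 0, w] : Matrix (Fin 9) (Fin 9) ℂ)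

/-! ### Temperley-Lieb sequences and Jones-Wenzl elements in an arbitrary algebra -/

/-! Necessity. A localization turns every `u_j` into one matrix U acting on the tensor factors j,
j+1 of (ℂ^m)^{⊗n}. The earlier generators that avoid factor j commute with the whole matrix algebra
on these two factors, so the normalized trace satisfies tr(x u_j) = (tr U / m²) tr(x)
(`normTrace_mul_localGen`). Hence d^j tr(p_j) satisfies the recursion of Δ_j(d) with the last
coefficient 1 replaced by κ = d tr U / m² (`IsTLSeq.jwTrace_step`). The idempotents p_j have
nonnegative trace and p_{k+1} = 0, while Δ_j(d) > 0 for j ≤ k and Δ_{k+1}(d) = 0; comparing the two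
solutions forces κ = 1 (`perturbation_eq_one`). Since U/d is idempotent, tr U is an integer multiple
of d up to a power of m, so κ = 1 makes d² = 4cos²(π/(k+2)) rational, and Niven's theorem leaves k =
1, 2, 4.

Sufficiency. Let U satisfy the local Temperley-Lieb relations with κ = 1. Then d^j tr(p_j) = Δ_j(d),
so p_{k+1} is an idempotent of trace 0, hence 0, and the earlier p_j are nonzero. The resulting
representation of TLJ_n is faithful (`IsTLSeq.injOn`): sandwiching a kernel element between last
generators reduces it to fewer strands, and an element killed by all sandwiches is a multiple of a
Jones-Wenzl projector. Solutions with d = √m, m = 1, 2, 3, are sums of rank one operators, one for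
each difference a - b modulo m, with roots of unity as coefficients; the Temperley-Lieb relations
become vanishing sums of roots of unity.

Indices: `jwSeq D u m` is p_{m+1}, and `initialAlg u m`, written B_m, is the algebra of m + 1
strands. -/

/-- `u 0, …, u (N - 1)` satisfy the Temperley-Lieb relations with loop parameter `d`. -/
structure IsTLSeq {B : Type*} [Ring B] [Algebra ℂ B] (d : ℂ) (N : ℕ) (u : ℕ → B) : Prop where
  sq : ∀ i < N, u i * u i = d • u i
  far : ∀ i j, i + 2 ≤ j → j < N → u i * u j = u j * u i
  up : ∀ i, i + 1 < N → u i * u (i + 1) * u i = u i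
  down : ∀ i, i + 1 < N → u (i + 1) * u i * u (i + 1) = u (i + 1)

/-- The Jones-Wenzl recursion for a sequence `u` with coefficients `D m / D (m + 1)`. -/
noncomputable def jwSeq {B : Type*} [Ring B] [Algebra ℂ B] (D : ℕ → ℂ) (u : ℕ → B) : ℕ → B
  | 0 => 1
  | m + 1 => jwSeq D u m - (D m / D (m + 1)) • (jwSeq D u m * u m * jwSeq D u m)

/-- The subalgebra generated by `u 0, …, u (m - 1)`. -/
def initialAlg {B : Type*} [Ring B] [Algebra ℂ B] (u : ℕ → B) (m : ℕ) : Subalgebra ℂ B :=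
  Algebra.adjoin ℂ (u '' Set.Iio m)

section
variable {B C : Type*} [Ring B] [Algebra ℂ B] [Ring C] [Algebra ℂ C] {d : ℂ} {N : ℕ} {u : ℕ → B}
  {D : ℕ → ℂ}

theorem IsTLSeq.map (hu : IsTLSeq d N u) (φ : B →ₐ[ℂ] C) : IsTLSeq d N (fun i => φ (u i)) where
  sq i hi := by rw [← map_mul, hu.sq i hi, map_smul]
  far i j h hj := by rw [← map_mul, hu.far i j h hj, map_mul]
  up i hi := by rw [← map_mul, ← map_mul, hu.up i hi]
  down i hi := by rw [← map_mul, ← map_mul, hu.down i hi]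

theorem map_jwSeq (φ : B →ₐ[ℂ] C) (m : ℕ) :
    φ (jwSeq D u m) = jwSeq D (fun i => φ (u i)) m := by
  induction m with
  | zero => simp [jwSeq]
  | succ m ih => simp [jwSeq, ih]

theorem gen_mem_initialAlg {i m : ℕ} (h : i < m) : u i ∈ initialAlg u m :=
  Algebra.subset_adjoin ⟨i, h, rfl⟩

theorem initialAlg_mono {m m' : ℕ} (h : m ≤ m') : initialAlg u m ≤ initialAlg u m' :=
  Algebra.adjoin_mono (Set.image_mono fun _ hi => lt_of_lt_of_le hi h)

theorem jwSeq_mem (m : ℕ) : jwSeq D u m ∈ initialAlg u m := by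
  induction m with
  | zero => exact one_mem _
  | succ m ih =>
    have ih' := initialAlg_mono (Nat.le_succ m) ih
    exact sub_mem ih' (Subalgebra.smul_mem _
      (mul_mem (mul_mem ih' (gen_mem_initialAlg (Nat.lt_succ_self m))) ih') _)

theorem commute_of_mem_initialAlg {m : ℕ} {x y : B} (hx : x ∈ initialAlg u m)
    (hy : ∀ i < m, Commute (u i) y) : Commute x y := by
  induction hx using Algebra.adjoin_induction with
  | mem z hz => obtain ⟨i, hi, rfl⟩ := hz; exact hy i hi
  | algebraMap r => exact Algebra.commutes r y
  | add a b _ _ ha hb => exact ha.add_left hb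
  | mul a b _ _ ha hb => exact ha.mul_left hb

theorem IsTLSeq.commute_gen (hu : IsTLSeq d N u) {m j : ℕ} (hmj : m + 1 ≤ j) (hj : j < N) {x : B}
    (hx : x ∈ initialAlg u m) : Commute x (u j) :=
  commute_of_mem_initialAlg hx fun i hi => hu.far i j (by omega) hj

/-- The recursion satisfied by `Δ_m(d)`. -/
structure IsChebSeq (d : ℂ) (D : ℕ → ℂ) : Prop where
  zero : D 0 = 1
  one : D 1 = d
  step : ∀ m, D (m + 2) = d * D (m + 1) - D m

/-- The characteristic properties of the Jones-Wenzl projector. -/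
structure IsJWProj (u : ℕ → B) (m : ℕ) (p : B) : Prop where
  idem : p * p = p
  left : ∀ j < m, u j * p = 0
  right : ∀ j < m, p * u j = 0

theorem jwSeq_succ_absorb (m : ℕ) (h : jwSeq D u m * jwSeq D u m = jwSeq D u m) :
    jwSeq D u m * jwSeq D u (m + 1) = jwSeq D u (m + 1) ∧
      jwSeq D u (m + 1) * jwSeq D u m = jwSeq D u (m + 1) := by
  constructor
  · simp only [jwSeq, mul_sub, mul_smul_comm, ← mul_assoc, h]
  · simp only [jwSeq, sub_mul, smul_mul_assoc, mul_assoc, h]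

/-- `u_{m+1} p u_{m+1}` for the Jones-Wenzl projector `p` just below. -/
theorem IsTLSeq.contraction_of_idem (hu : IsTLSeq d N u) (hD : IsChebSeq d D) {m : ℕ}
    (hm : m + 1 < N) (hD0 : D (m + 1) ≠ 0)
    (hp : jwSeq D u m * jwSeq D u m = jwSeq D u m) :
    u (m + 1) * jwSeq D u (m + 1) * u (m + 1) =
      (D (m + 2) / D (m + 1)) • (jwSeq D u m * u (m + 1)) := by
  have hc : jwSeq D u m * u (m + 1) = u (m + 1) * jwSeq D u m :=
    hu.commute_gen le_rfl hm (jwSeq_mem m)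
  set p := jwSeq D u m with hp_def
  have h1 : u (m + 1) * p * u (m + 1) = d • (p * u (m + 1)) := by
    rw [← hc, mul_assoc, hu.sq _ hm, mul_smul_comm]
  have h2 : u (m + 1) * (p * u m * p) * u (m + 1) = p * u (m + 1) := by
    calc u (m + 1) * (p * u m * p) * u (m + 1)
        = (u (m + 1) * p) * u m * (p * u (m + 1)) := by noncomm_ring
      _ = (p * u (m + 1)) * u m * (u (m + 1) * p) := by rw [hc]
      _ = p * (u (m + 1) * u m * u (m + 1)) * p := by noncomm_ring
      _ = p * u (m + 1) := by rw [hu.down m hm, mul_assoc, ← hc, ← mul_assoc, hp]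
  have : jwSeq D u (m + 1) = p - (D m / D (m + 1)) • (p * u m * p) := rfl
  rw [this, mul_sub, sub_mul, h1, mul_smul_comm, smul_mul_assoc, h2, ← sub_smul]
  congr 1
  rw [hD.step]
  field_simp

/-- The only new relations are those with the last generator. They hold because contraction makes `u
m * jwSeq D u m` idempotent up to the factor `D (m + 1) / D m`, the inverse of the coefficient in
the recursion. The induction is strong because contraction uses idempotency one step further down.
-/
theorem IsTLSeq.isJWProj_jwSeq (hu : IsTLSeq d N u) (hD : IsChebSeq d D) (m : ℕ) (hm : m ≤ N)
    (hD0 : ∀ i ≤ m, D i ≠ 0) : IsJWProj u m (jwSeq D u m) := by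
  induction m using Nat.strong_induction_on with
  | h m ih =>
    rcases m with _ | m
    · exact ⟨by simp [jwSeq], by simp, by simp⟩
    have hp := ih m (by omega) (by omega) fun i hi => hD0 i (by omega)
    have hne := hD0 (m + 1) le_rfl
    have hne' := hD0 m (by omega)
    have habs := jwSeq_succ_absorb m hp.idem
    have key : u m * jwSeq D u m * u m * jwSeq D u m = (D (m + 1) / D m) • (u m * jwSeq D u m) ∧
        jwSeq D u m * (u m * jwSeq D u m * u m) = (D (m + 1) / D m) • (jwSeq D u m * u m) := by
      rcases m with _ | l
      · simp [jwSeq, hu.sq 0 (by omega), hD.zero, hD.one]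
      · have hc : Commute (jwSeq D u l) (u (l + 1)) :=
          hu.commute_gen le_rfl (by omega) (jwSeq_mem l)
        have hl : jwSeq D u l * jwSeq D u l = jwSeq D u l :=
          (ih l (by omega) (by omega) fun i hi => hD0 i (by omega)).idem
        have ha := jwSeq_succ_absorb (D := D) (u := u) l hl
        rw [hu.contraction_of_idem hD (by omega) hne' hl]
        constructor
        · rw [smul_mul_assoc, hc.eq, mul_assoc, ha.1]
        · rw [mul_smul_comm, ← mul_assoc, ha.2]
    have hdef : jwSeq D u (m + 1) =
        jwSeq D u m - (D m / D (m + 1)) • (jwSeq D u m * u m * jwSeq D u m) := rfl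
    have hcoef : D m / D (m + 1) * (D (m + 1) / D m) = 1 := by field_simp
    have hL : ∀ j < m + 1, u j * jwSeq D u (m + 1) = 0 := by
      intro j hj
      rcases Nat.lt_succ_iff_lt_or_eq.1 hj with hj | rfl
      · rw [← habs.1, ← mul_assoc, hp.left j hj, zero_mul]
      · rw [hdef, mul_sub, mul_smul_comm, ← mul_assoc, ← mul_assoc, key.1, smul_smul, hcoef,
          one_smul, sub_self]
    have hR : ∀ j < m + 1, jwSeq D u (m + 1) * u j = 0 := by
      intro j hj
      rcases Nat.lt_succ_iff_lt_or_eq.1 hj with hj | rfl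
      · rw [← habs.2, mul_assoc, hp.right j hj, mul_zero]
      · rw [hdef, sub_mul, smul_mul_assoc, mul_assoc, mul_assoc, ← mul_assoc (u j), key.2,
          smul_smul, hcoef, one_smul, sub_self]
    refine ⟨?_, hL, hR⟩
    nth_rewrite 2 [hdef]
    rw [mul_sub, habs.2, mul_smul_comm, ← mul_assoc, ← mul_assoc, habs.2, hR m (by omega),
      zero_mul, smul_zero, sub_zero]

theorem IsTLSeq.contraction (hu : IsTLSeq d N u) (hD : IsChebSeq d D) {m : ℕ}
    (hm : m + 1 < N) (hD0 : ∀ i ≤ m + 1, D i ≠ 0) :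
    u (m + 1) * jwSeq D u (m + 1) * u (m + 1) =
      (D (m + 2) / D (m + 1)) • (jwSeq D u m * u (m + 1)) :=
  hu.contraction_of_idem hD hm (hD0 _ le_rfl)
    (hu.isJWProj_jwSeq hD m (by omega) fun i hi => hD0 i (by omega)).idem

end

/-! ### Normal forms, sandwich relations and the injectivity criterion -/

section
variable {B C : Type*} [Ring B] [Algebra ℂ B] [Ring C] [Algebra ℂ C] {d : ℂ} {N : ℕ} {u : ℕ → B}
  {D : ℕ → ℂ}

/-- The span of `B_m` and `B_m u_m B_m`. -/
def reducedSpan (u : ℕ → B) (m : ℕ) : Submodule ℂ B :=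
  Subalgebra.toSubmodule (initialAlg u m) ⊔
    Submodule.span ℂ {z | ∃ a ∈ initialAlg u m, ∃ b ∈ initialAlg u m, z = a * u m * b}

theorem reducedSpan_induction {m : ℕ} {P : B → Prop} (h1 : ∀ x ∈ initialAlg u m, P x)
    (h2 : ∀ a ∈ initialAlg u m, ∀ b ∈ initialAlg u m, P (a * u m * b))
    (hadd : ∀ x y, P x → P y → P (x + y)) (hsmul : ∀ (c : ℂ) x, P x → P (c • x))
    {x : B} (hx : x ∈ reducedSpan u m) : P x := by
  obtain ⟨y, hy, z, hz, rfl⟩ := Submodule.mem_sup.1 hx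
  refine hadd _ _ (h1 y hy) ?_
  clear hx
  induction hz using Submodule.span_induction with
  | mem z hz => obtain ⟨a, ha, b, hb, rfl⟩ := hz; exact h2 a ha b hb
  | zero => exact h1 0 (zero_mem _)
  | add x y _ _ hx hy => exact hadd _ _ hx hy
  | smul c x _ hx => exact hsmul _ _ hx

theorem mem_reducedSpan_mul {m : ℕ} {a b : B} (ha : a ∈ initialAlg u m) (hb : b ∈ initialAlg u m) :
    a * u m * b ∈ reducedSpan u m :=
  Submodule.mem_sup_right (Submodule.subset_span ⟨a, ha, b, hb, rfl⟩)

/-- Words with at most one `u m` suffice: their span contains 1 and is stable under left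
multiplication by generators, since `u m * a * u m` collapses. The collapse is a hypothesis so that
it can be proved in a joint induction with this normal form. -/
theorem initialAlg_succ_subset_of_sandwich {m : ℕ}
    (h : ∀ x ∈ initialAlg u m, ∃ y ∈ initialAlg u (m - 1), u m * x * u m = y * u m)
    {x : B} (hx : x ∈ initialAlg u (m + 1)) : x ∈ reducedSpan u m := by
  suffices H : ∀ t ∈ reducedSpan u m, x * t ∈ reducedSpan u m by
    simpa using H 1 (Submodule.mem_sup_left (one_mem (initialAlg u m)))
  induction hx using Algebra.adjoin_induction with
  | mem z hz =>
    obtain ⟨i, hi, rfl⟩ := hz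
    intro t ht
    refine reducedSpan_induction (P := fun t => u i * t ∈ reducedSpan u m) ?_ ?_ ?_ ?_ ht
    · intro x hx
      rcases Nat.lt_succ_iff_lt_or_eq.1 hi with hi | rfl
      · have : u i * x ∈ initialAlg u m := mul_mem (gen_mem_initialAlg hi) hx
        exact Submodule.mem_sup_left this
      · simpa using mem_reducedSpan_mul (one_mem _) hx
    · intro a ha b hb
      rcases Nat.lt_succ_iff_lt_or_eq.1 hi with hi | rfl
      · simpa only [← mul_assoc] using
          mem_reducedSpan_mul (mul_mem (gen_mem_initialAlg hi) ha) hb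
      · obtain ⟨y, hy, h'⟩ := h a ha
        rw [← mul_assoc, ← mul_assoc, h']
        exact mem_reducedSpan_mul (initialAlg_mono (Nat.sub_le _ _) hy) hb
    · intro x y hx hy
      rw [mul_add]; exact add_mem hx hy
    · intro c x hx
      rw [mul_smul_comm]; exact Submodule.smul_mem _ _ hx
  | algebraMap r =>
    intro t ht
    rw [← Algebra.smul_def]; exact Submodule.smul_mem _ _ ht
  | add a b _ _ ha hb => intro t ht; rw [add_mul]; exact add_mem (ha t ht) (hb t ht)
  | mul a b _ _ ha hb => intro t ht; rw [mul_assoc]; exact ha _ (hb t ht)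

/-- For x in B_{m+1} the normal form has at most one `u m`; B_m commutes with `u (m + 1)`, and `u (m
+ 1) * u m * u (m + 1) = u (m + 1)` removes what remains. -/
theorem IsTLSeq.sandwich (hu : IsTLSeq d N u) {m : ℕ} (hm : m < N) :
    ∀ x ∈ initialAlg u m, ∃ y ∈ initialAlg u (m - 1), u m * x * u m = y * u m := by
  induction m with
  -- With truncated subtraction both algebras are the scalars here, and the loop relation is all
  -- that is needed.
  | zero =>
    intro x hx
    simp only [initialAlg, Set.Iio_zero_eq_empty, Set.image_empty, Algebra.adjoin_empty,
      Algebra.mem_bot] at hx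
    obtain ⟨c, rfl⟩ := hx
    refine ⟨algebraMap ℂ B (c * d), Subalgebra.algebraMap_mem _ _, ?_⟩
    rw [← Algebra.commutes, mul_assoc, hu.sq 0 hm, map_mul, mul_assoc, Algebra.smul_def]
  | succ m ih =>
    intro x hx
    have hc : ∀ a ∈ initialAlg u m, a * u (m + 1) = u (m + 1) * a := fun a ha =>
      hu.commute_gen le_rfl hm ha
    refine reducedSpan_induction
      (P := fun x => ∃ y ∈ initialAlg u m, u (m + 1) * x * u (m + 1) = y * u (m + 1))
      ?_ ?_ ?_ ?_ (initialAlg_succ_subset_of_sandwich (ih (by omega)) hx)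
    · intro x hx
      refine ⟨d • x, Subalgebra.smul_mem _ hx _, ?_⟩
      rw [← hc x hx, mul_assoc, hu.sq _ hm, mul_smul_comm, smul_mul_assoc]
    · intro a ha b hb
      refine ⟨a * b, mul_mem ha hb, ?_⟩
      calc u (m + 1) * (a * u m * b) * u (m + 1)
          = (u (m + 1) * a) * u m * (b * u (m + 1)) := by noncomm_ring
        _ = (a * u (m + 1)) * u m * (u (m + 1) * b) := by rw [hc a ha, hc b hb]
        _ = a * (u (m + 1) * u m * u (m + 1)) * b := by noncomm_ring
        _ = a * b * u (m + 1) := by rw [hu.down m hm, mul_assoc, ← hc b hb, ← mul_assoc]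
    · rintro x y ⟨x', hx', hx⟩ ⟨y', hy', hy⟩
      exact ⟨x' + y', add_mem hx' hy', by rw [mul_add, add_mul, add_mul, hx, hy]⟩
    · rintro c x ⟨x', hx', hx⟩
      exact ⟨c • x', Subalgebra.smul_mem _ hx' _, by
        rw [mul_smul_comm, smul_mul_assoc, hx, smul_mul_assoc]⟩

/-- `u_m B_{m+1} u_m ⊆ B_{m-1} u_m`. -/
theorem IsTLSeq.sandwich_succ (hu : IsTLSeq d N u) {m : ℕ} (hm : m < N) {x : B}
    (hx : x ∈ initialAlg u (m + 1)) :
    ∃ y ∈ initialAlg u (m - 1), u m * x * u m = y * u m := by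
  refine reducedSpan_induction
    (P := fun x => ∃ y ∈ initialAlg u (m - 1), u m * x * u m = y * u m)
    (hu.sandwich hm) ?_ ?_ ?_ (initialAlg_succ_subset_of_sandwich (hu.sandwich hm) hx)
  · intro a ha b hb
    obtain ⟨y, hy, ha⟩ := hu.sandwich hm a ha
    obtain ⟨z, hz, hb⟩ := hu.sandwich hm b hb
    refine ⟨y * z, mul_mem hy hz, ?_⟩
    rw [← mul_assoc, ← mul_assoc, ha, mul_assoc, mul_assoc, ← mul_assoc (u m), hb, mul_assoc]
  · rintro x y ⟨x', hx', hx⟩ ⟨y', hy', hy⟩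
    exact ⟨x' + y', add_mem hx' hy', by rw [mul_add, add_mul, add_mul, hx, hy]⟩
  · rintro c x ⟨x', hx', hx⟩
    exact ⟨c • x', Subalgebra.smul_mem _ hx' _, by
      rw [mul_smul_comm, smul_mul_assoc, hx, smul_mul_assoc]⟩

/-- Only the constant term of a word in the generators survives against p, so the same c serves on
both sides. -/
theorem IsJWProj.scalar {m : ℕ} {p : B} (hp : IsJWProj u m p) {x : B} (hx : x ∈ initialAlg u m) :
    ∃ c : ℂ, x * p = c • p ∧ p * x = c • p := by
  induction hx using Algebra.adjoin_induction with
  | mem z hz =>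
    obtain ⟨i, hi, rfl⟩ := hz
    exact ⟨0, by rw [hp.left i hi, zero_smul], by rw [hp.right i hi, zero_smul]⟩
  | algebraMap r =>
    exact ⟨r, by rw [Algebra.smul_def], by rw [← Algebra.commutes, Algebra.smul_def]⟩
  | add a b _ _ ha hb =>
    obtain ⟨c, h1, h2⟩ := ha
    obtain ⟨e, h3, h4⟩ := hb
    exact ⟨c + e, by rw [add_mul, h1, h3, add_smul], by rw [mul_add, h2, h4, add_smul]⟩
  | mul a b _ _ ha hb =>
    obtain ⟨c, h1, h2⟩ := ha
    obtain ⟨e, h3, h4⟩ := hb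
    refine ⟨c * e, ?_, ?_⟩
    · rw [mul_assoc, h3, mul_smul_comm, h1, smul_smul, mul_comm]
    · rw [← mul_assoc, h2, smul_mul_assoc, h4, smul_smul]

/-- An element annihilated by the ideal of `u_0, …, u_{j-1}` on both sides is annihilated by
`1 - J_m` for `m ≤ j` on both sides. -/
theorem one_sub_jwSeq_sandwich {j m : ℕ} (hmj : m ≤ j) {x : B}
    (h : ∀ i < j, ∀ l < j, ∀ a ∈ initialAlg u j, ∀ b ∈ initialAlg u j,
      u i * a * x * b * u l = 0) :
    (1 - jwSeq D u m) * x * (1 - jwSeq D u m) = 0 := by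
  have hL : ∀ m ≤ j, ∀ a ∈ initialAlg u j, ∀ l < j, ∀ b ∈ initialAlg u j,
      (1 - jwSeq D u m) * a * x * b * u l = 0 := by
    intro m hm
    induction m with
    | zero => intros; simp [jwSeq]
    | succ m ih =>
      intro a ha l hl b hb
      have hJ : jwSeq D u m ∈ initialAlg u j := initialAlg_mono (by omega) (jwSeq_mem m)
      -- The recursion adds to `1 - jwSeq D u m` a term containing `u m`; its outer factors are
      -- absorbed in the free a and b.
      have : (1 - jwSeq D u (m + 1)) * a * x * b * u l = (1 - jwSeq D u m) * a * x * b * u l +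
          (D m / D (m + 1)) • (jwSeq D u m * (u m * (jwSeq D u m * a) * x * b * u l)) := by
        simp only [jwSeq, sub_mul, smul_mul_assoc, mul_assoc]
        abel
      rw [this, ih (by omega) a ha l hl b hb, h m (by omega) l hl _ (mul_mem hJ ha) b hb]
      simp
  have hR : ∀ m' ≤ j, ∀ b ∈ initialAlg u j,
      (1 - jwSeq D u m) * x * b * (1 - jwSeq D u m') = 0 := by
    intro m' hm
    induction m' with
    | zero => intros; simp [jwSeq]
    | succ m' ih =>
      intro b hb
      have hJ : jwSeq D u m' ∈ initialAlg u j := initialAlg_mono (by omega) (jwSeq_mem m')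
      have : (1 - jwSeq D u m) * x * b * (1 - jwSeq D u (m' + 1)) =
          (1 - jwSeq D u m) * x * b * (1 - jwSeq D u m') + (D m' / D (m' + 1)) •
            ((1 - jwSeq D u m) * 1 * x * (b * jwSeq D u m') * u m' * jwSeq D u m') := by
        rw [mul_one]
        conv_lhs => rw [jwSeq]
        generalize (1 - jwSeq D u m) = q
        simp only [mul_sub, mul_smul_comm, mul_assoc]
        abel
      rw [this, ih (by omega) b hb, hL m hmj 1 (one_mem _) m' (by omega) _ (mul_mem hb hJ)]
      simp
  simpa using hR m hmj 1 (one_mem _)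

/-- A homomorphism from an algebra with Jones-Wenzl element `J_K = 0` is injective on the
subalgebra of a Temperley-Lieb sequence if it does not kill the earlier Jones-Wenzl elements and
`u_j` can be cancelled in the image against elements of `B_{j-1}`. -/
theorem IsTLSeq.injOn (hu : IsTLSeq d N u) (hD : IsChebSeq d D) (φ : B →ₐ[ℂ] C) (K : ℕ)
    (hD0 : ∀ i ≤ K, D i ≠ 0) (hJ : K ≤ N → jwSeq D u K = 0)
    (hne : ∀ j < K, j ≤ N → φ (jwSeq D u j) ≠ 0)
    (hcancel : ∀ j < N, ∀ y ∈ initialAlg u (j - 1), φ y * φ (u j) = 0 → φ y = 0)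
    {j : ℕ} (hj : j ≤ N) {x : B} (hx : x ∈ initialAlg u j) (hφ : φ x = 0) : x = 0 := by
  induction j using Nat.strong_induction_on generalizing x with
  | h j ih =>
    -- Between two copies of the last generator everything collapses to `y * u j'`. Cancelling `φ (u
    -- j')` puts y in the kernel, two generators lower, where the induction hypothesis applies.
    have top : ∀ j', j = j' + 1 → ∀ a ∈ initialAlg u j, ∀ b ∈ initialAlg u j,
        u j' * a * x * b * u j' = 0 := by
      rintro j' rfl a ha b hb
      obtain ⟨y, hy, h⟩ := hu.sandwich_succ (by omega : j' < N) (mul_mem (mul_mem ha hx) hb)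
      have h' : u j' * a * x * b * u j' = y * u j' := by rw [← h]; simp only [mul_assoc]
      have hy0 : φ y = 0 := by
        refine hcancel j' (by omega) y hy ?_
        rw [← map_mul, ← h', map_mul, map_mul, map_mul, map_mul, hφ]
        simp
      rw [h', ih (j' - 1) (by omega) (by omega) hy hy0, zero_mul]
    -- Descend from the last generator to all the others by `u i = u i * u (i + 1) * u i`.
    have left : ∀ i < j, ∀ j', j = j' + 1 → ∀ a ∈ initialAlg u j, ∀ b ∈ initialAlg u j,
        u i * a * x * b * u j' = 0 := by
      intro i hi j' hj'
      have hij : i ≤ j' := by omega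
      induction hij using Nat.decreasingInduction with
      | self => exact top j' hj'
      | of_succ i hi' ih' =>
        intro a ha b hb
        have := ih' (by omega) (u i * a) (mul_mem (gen_mem_initialAlg hi) ha) b hb
        rw [← hu.up i (by omega)]
        calc u i * u (i + 1) * u i * a * x * b * u j'
            = u i * (u (i + 1) * (u i * a) * x * b * u j') := by simp only [mul_assoc]
          _ = 0 := by rw [this, mul_zero]
    have both : ∀ i < j, ∀ l < j, ∀ a ∈ initialAlg u j, ∀ b ∈ initialAlg u j,
        u i * a * x * b * u l = 0 := by
      intro i hi l hl
      obtain ⟨j', rfl⟩ : ∃ j', j = j' + 1 := ⟨j - 1, by omega⟩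
      have hlj : l ≤ j' := by omega
      induction hlj using Nat.decreasingInduction with
      | self => exact left i hi j' rfl
      | of_succ l hl' ih' =>
        intro a ha b hb
        have := ih' (by omega) a ha (b * u l) (mul_mem hb (gen_mem_initialAlg hl))
        rw [← hu.up l (by omega)]
        calc u i * a * x * b * (u l * u (l + 1) * u l)
            = (u i * a * x * (b * u l) * u (l + 1)) * u l := by simp only [mul_assoc]
          _ = 0 := by rw [this, zero_mul]
    -- If K ≤ j, the vanishing Jones-Wenzl element turns the sandwich by `1 - jwSeq D u K` into x
    -- itself. Otherwise x is a multiple of `jwSeq D u j`, which φ does not kill.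
    by_cases hK : K ≤ j
    · simpa [hJ (hK.trans hj)] using one_sub_jwSeq_sandwich (D := D) hK both
    · have hp := hu.isJWProj_jwSeq hD j hj fun i hi => hD0 i (by omega)
      have h := one_sub_jwSeq_sandwich (D := D) le_rfl both
      obtain ⟨c, h1, h2⟩ := hp.scalar hx
      have hxc : x = c • jwSeq D u j := by
        rw [sub_mul, one_mul, h2, mul_sub, mul_one, sub_mul, h1, smul_mul_assoc, hp.idem, sub_self,
          sub_zero, sub_eq_zero] at h
        exact h
      rw [hxc, map_smul, smul_eq_zero] at hφ
      rcases hφ with rfl | hφ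
      · rw [hxc, zero_smul]
      · exact absurd hφ (hne j (by omega) hj)

end

/-! ### Traces of Jones-Wenzl elements -/

section
variable {B : Type*} [Ring B] [Algebra ℂ B] {d : ℂ} {N : ℕ} {u : ℕ → B} {D : ℕ → ℂ}

theorem trace_jwSeq_one (hD : IsChebSeq d D) (T : B →ₗ[ℂ] ℂ) :
    T (jwSeq D u 1) = T 1 - d⁻¹ * T (u 0) := by
  simp [jwSeq, hD.zero, hD.one]

/-- By cyclicity and idempotency T(pup) = T(pu) = d⁻¹ T(upu), and contraction evaluates the last
term. The coefficients of the recursion cancel, so any trace will do; no Markov property is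
involved. -/
theorem IsTLSeq.trace_jwSeq_add_two (hu : IsTLSeq d N u) (hD : IsChebSeq d D) (T : B →ₗ[ℂ] ℂ)
    (hT : ∀ x y, T (x * y) = T (y * x)) (hd : d ≠ 0) {m : ℕ} (hm : m + 1 < N)
    (hD0 : ∀ i ≤ m + 2, D i ≠ 0) : T (jwSeq D u (m + 2)) =
      T (jwSeq D u (m + 1)) - d⁻¹ * T (jwSeq D u m * u (m + 1)) := by
  have h0 : ∀ i ≤ m + 1, D i ≠ 0 := fun i hi => hD0 i (by omega)
  have h2 := hD0 (m + 2) le_rfl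
  have hp := hu.isJWProj_jwSeq hD (m + 1) hm.le h0
  have hc := hu.contraction hD hm h0
  set p := jwSeq D u (m + 1) with hp_def
  have e1 : T (p * u (m + 1) * p) = d⁻¹ * ((D (m + 2) / D (m + 1)) *
      T (jwSeq D u m * u (m + 1))) := by
    have : T (u (m + 1) * p * u (m + 1)) = d * T (p * u (m + 1)) := by
      rw [hT, ← mul_assoc, hu.sq _ hm, smul_mul_assoc, map_smul, hT, smul_eq_mul]
    rw [hc, map_smul, smul_eq_mul] at this
    rw [hT, ← mul_assoc, hp.idem, this, inv_mul_cancel_left₀ hd]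
  have h3 : jwSeq D u (m + 2) = p - (D (m + 1) / D (m + 2)) • (p * u (m + 1) * p) := rfl
  rw [h3, map_sub, map_smul, smul_eq_mul, e1]
  have := h0 (m + 1) le_rfl
  field_simp

end

/-! ### Matrix subalgebras, their centralizers and traces of idempotents -/

section
variable {p : Type*} [Fintype p] [DecidableEq p] {C : Type*} [Ring C] [Algebra ℂ C]

/-- A nonzero element of a matrix subalgebra can be cancelled against its centralizer. -/
theorem eq_zero_of_mul_matrix_eq_zero (φ : Matrix p p ℂ →ₐ[ℂ] C) {U : Matrix p p ℂ} (hU : U ≠ 0)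
    {x : C} (hx : ∀ M, Commute x (φ M)) (h : x * φ U = 0) : x = 0 := by
  obtain ⟨a, b, hab⟩ : ∃ a b, U a b ≠ 0 := by
    by_contra! H
    exact hU (Matrix.ext H)
  -- Simplicity of the matrix algebra made explicit: 1 lies in the two-sided ideal generated by U.
  have h1 : (1 : Matrix p p ℂ) =
      (U a b)⁻¹ • ∑ i, Matrix.single i a 1 * U * Matrix.single b i 1 := by
    simp only [Matrix.single_mul_mul_single, one_mul, mul_one]
    rw [Finset.smul_sum, ← Matrix.sum_single_one]
    refine Finset.sum_congr rfl fun i _ => ?_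
    rw [Matrix.smul_single, smul_eq_mul, inv_mul_cancel₀ hab]
  have : x * φ 1 = 0 := by
    rw [h1, map_smul, map_sum, mul_smul_comm, Finset.mul_sum]
    refine smul_eq_zero_of_right _ (Finset.sum_eq_zero fun i _ => ?_)
    rw [map_mul, map_mul, ← mul_assoc, ← mul_assoc, (hx _).eq, mul_assoc _ x, h]
    simp
  simpa using this

/-- A tracial functional factorizes on the product of a matrix subalgebra and its centralizer. -/
theorem trace_mul_matrix (φ : Matrix p p ℂ →ₐ[ℂ] C) (T : C →ₗ[ℂ] ℂ)
    (hT : ∀ x y, T (x * y) = T (y * x)) {x : C} (hx : ∀ M, Commute x (φ M)) (M : Matrix p p ℂ) :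
    T (x * φ M) * Fintype.card p = T x * M.trace := by
  -- The functional M ↦ T(x φ(M)) is a trace on a full matrix algebra, hence a multiple of the
  -- matrix trace; matrix units determine the multiple.
  have hmul : ∀ M N, T (x * φ (M * N)) = T (x * φ (N * M)) := by
    intro M N
    rw [map_mul φ, map_mul φ, ← mul_assoc, hT, ← mul_assoc, ← (hx N).eq, mul_assoc]
  have hoff : ∀ i j, i ≠ j → T (x * φ (Matrix.single i j 1)) = 0 := by
    intro i j hij
    have h1 : (Matrix.single i j (1 : ℂ)) = Matrix.single i j 1 * Matrix.single j j 1 := by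
      rw [Matrix.single_mul_single_same, one_mul]
    rw [h1, hmul, Matrix.single_mul_single_of_ne _ _ _ _ hij.symm, map_zero, mul_zero, map_zero]
  have hdiag : ∀ i j, T (x * φ (Matrix.single i i 1)) = T (x * φ (Matrix.single j j 1)) := by
    intro i j
    have h1 : (Matrix.single i i (1 : ℂ)) = Matrix.single i j 1 * Matrix.single j i 1 := by
      rw [Matrix.single_mul_single_same, one_mul]
    rw [h1, hmul, Matrix.single_mul_single_same, one_mul]
  have hone : ∀ j, T x = T (x * φ (Matrix.single j j 1)) * Fintype.card p := by
    intro j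
    calc T x = T (x * φ 1) := by rw [map_one, mul_one]
      _ = ∑ i, T (x * φ (Matrix.single i i 1)) := by
        rw [← Matrix.sum_single_one, map_sum, Finset.mul_sum, map_sum]
      _ = _ := by
        rw [Finset.sum_congr rfl fun i _ => hdiag i j, Finset.sum_const, Finset.card_univ,
          nsmul_eq_mul, mul_comm]
  have hsingle : ∀ i j c, T (x * φ (Matrix.single i j c)) * Fintype.card p =
      if i = j then T x * c else 0 := by
    intro i j c
    have hc : Matrix.single i j c = c • Matrix.single i j (1 : ℂ) := by
      rw [Matrix.smul_single, smul_eq_mul, mul_one]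
    rw [hc, map_smul, mul_smul_comm, map_smul, smul_eq_mul]
    split_ifs with hij
    · subst hij
      rw [hone i]; ring
    · rw [hoff i j hij]; ring
  conv_lhs => rw [Matrix.matrix_eq_sum_single M]
  simp only [map_sum, Finset.mul_sum, Finset.sum_mul, hsingle]
  simp [Matrix.trace, Finset.mul_sum]

/-- The trace is the rank. Integrality gives the rationality in the necessity argument, and
nonnegativity gives its positivity. -/
theorem exists_nat_trace_of_idem {M : Matrix p p ℂ} (hM : M * M = M) : ∃ t : ℕ, M.trace = t := by
  have : IsIdempotentElem (Matrix.toLin' M) := by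
    rw [IsIdempotentElem, Module.End.mul_eq_comp, ← Matrix.toLin'_mul, hM]
  rw [← Matrix.trace_toLin'_eq]
  exact ⟨_, (LinearMap.IsIdempotentElem.isProj_range _ this).trace⟩

theorem eq_zero_of_idem_of_trace {M : Matrix p p ℂ} (hM : M * M = M) (h : M.trace = 0) :
    M = 0 := by
  have : IsIdempotentElem (Matrix.toLin' M) := by
    rw [IsIdempotentElem, Module.End.mul_eq_comp, ← Matrix.toLin'_mul, hM]
  rw [← Matrix.trace_toLin'_eq] at h
  exact Matrix.toLin'.map_eq_zero_iff.1 ((LinearMap.IsIdempotentElem.trace_eq_zero_iff this).1 h)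

end

/-! ### Local Temperley-Lieb representations on tensor powers -/

section
variable {ι κ α : Type*} [Fintype ι] [Fintype κ] [DecidableEq ι] [DecidableEq κ] [DecidableEq α]
  [Fintype α]

/-- `promote` as an algebra homomorphism. -/
def promoteHom (s : ι ↪ κ) : Matrix (ι → α) (ι → α) ℂ →ₐ[ℂ] Matrix (κ → α) (κ → α) ℂ :=
  AlgHom.ofLinearMap
    { toFun := promote s
      map_add' := fun M N => by
        ext f g
        simp only [promote, Matrix.of_apply, Matrix.add_apply]
        split_ifs <;> simp
      map_smul' := fun c M => by
        ext f g
        simp only [promote, Matrix.of_apply, Matrix.smul_apply, RingHom.id_apply]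
        split_ifs <;> simp }
    (promote_one s) (fun M N => (promote_mul s M N).symm)

@[simp]
theorem promoteHom_apply (s : ι ↪ κ) (M : Matrix (ι → α) (ι → α) ℂ) :
    promoteHom s M = promote s M := rfl

end

/-- The relations on `(ℂ^m)^{⊗ 2}` and `(ℂ^m)^{⊗ 3}` that make the shifts of `U` satisfy the
Temperley-Lieb relations. -/
structure IsLocalTL {m : ℕ} (d : ℂ) (U : Matrix (Fin 2 → Fin m) (Fin 2 → Fin m) ℂ) : Prop where
  sq : U * U = d • U
  up : promote (adjacent (n := 3) 0) U * promote (adjacent (n := 3) 1) U *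
    promote (adjacent (n := 3) 0) U = promote (adjacent (n := 3) 0) U
  down : promote (adjacent (n := 3) 1) U * promote (adjacent (n := 3) 0) U *
    promote (adjacent (n := 3) 1) U = promote (adjacent (n := 3) 1) U

/-- `U` acting on the tensor factors `j, j + 1` among `n`. -/
noncomputable def localGen {m : ℕ} (U : Matrix (Fin 2 → Fin m) (Fin 2 → Fin m) ℂ) (n j : ℕ) :
    Matrix (Fin n → Fin m) (Fin n → Fin m) ℂ :=
  if h : j < n - 1 then promote (adjacent ⟨j, h⟩) U else 0

section
variable {m : ℕ} {d : ℂ} {U : Matrix (Fin 2 → Fin m) (Fin 2 → Fin m) ℂ} {D : ℕ → ℂ}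

theorem localGen_of_lt {n j : ℕ} (h : j < n - 1) :
    localGen U n j = promote (adjacent ⟨j, h⟩) U := dif_pos h

theorem adjacent_eq_trans_zero {n j : ℕ} (h : j + 1 < n - 1) :
    adjacent (n := n) ⟨j, by omega⟩ =
      (adjacent (n := 3) 0).trans (consecutive j (by omega)) := by
  ext a
  change j + a.val = j + (0 + a.val)
  omega

theorem adjacent_eq_trans_one {n j : ℕ} (h : j + 1 < n - 1) :
    adjacent (n := n) ⟨j + 1, h⟩ = (adjacent (n := 3) 1).trans (consecutive j (by omega)) := by
  ext a
  change j + 1 + a.val = j + (1 + a.val)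
  omega

theorem IsLocalTL.isTLSeq (hU : IsLocalTL d U) (n : ℕ) : IsTLSeq d (n - 1) (localGen U n) where
  sq i hi := by
    rw [localGen_of_lt hi, promote_mul, hU.sq, ← promoteHom_apply, map_smul, promoteHom_apply]
  far i j h hj := by
    rw [localGen_of_lt hj, localGen_of_lt (by omega)]
    refine promote_commute _ _ (fun a b hab => ?_) _ _
    have h' : i + a.val = j + b.val := congrArg Fin.val hab
    omega
  up i hi := by
    rw [localGen_of_lt hi, localGen_of_lt (by omega), adjacent_eq_trans_zero hi,
      adjacent_eq_trans_one hi, ← promote_promote, ← promote_promote, promote_mul, promote_mul,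
      hU.up]
  down i hi := by
    rw [localGen_of_lt hi, localGen_of_lt (by omega), adjacent_eq_trans_zero hi,
      adjacent_eq_trans_one hi, ← promote_promote, ← promote_promote, promote_mul, promote_mul,
      hU.down]

theorem commute_localGen {n j l : ℕ} (h : l + 1 ≤ j) (hj : j < n - 1)
    {x : Matrix (Fin n → Fin m) (Fin n → Fin m) ℂ} (hx : x ∈ initialAlg (localGen U n) l)
    (M : Matrix (Fin 2 → Fin m) (Fin 2 → Fin m) ℂ) :
    Commute x (promoteHom (adjacent ⟨j, hj⟩) M) := by
  refine commute_of_mem_initialAlg hx fun i hi => ?_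
  rw [localGen_of_lt (by omega)]
  refine promote_commute _ _ (fun a b hab => ?_) _ _
  have h' : i + a.val = j + b.val := congrArg Fin.val hab
  omega

theorem commute_localGen_zero {n : ℕ} (j : Fin (n - 1))
    {x : Matrix (Fin n → Fin m) (Fin n → Fin m) ℂ} (hx : x ∈ initialAlg (localGen U n) 0)
    (M : Matrix (Fin 2 → Fin m) (Fin 2 → Fin m) ℂ) :
    Commute x (promoteHom (adjacent j) M) :=
  commute_of_mem_initialAlg hx fun i hi => absurd hi (Nat.not_lt_zero i)

/-- The generators below index j - 1 touch only factors before j. Commutation with every M, not just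
with U, is what lets the trace factorize and `localGen U n j` be cancelled. For j = 0 the algebra is
the scalars. -/
theorem commute_localGen_sub_one {n j : ℕ} (hj : j < n - 1)
    {x : Matrix (Fin n → Fin m) (Fin n → Fin m) ℂ} (hx : x ∈ initialAlg (localGen U n) (j - 1))
    (M : Matrix (Fin 2 → Fin m) (Fin 2 → Fin m) ℂ) :
    Commute x (promoteHom (adjacent ⟨j, hj⟩) M) := by
  rcases j with _ | j
  · exact commute_localGen_zero _ hx M
  · exact commute_localGen le_rfl hj hx M

/-- The normalized trace on `(ℂ^m)^{⊗ n}`. -/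
noncomputable def normTrace (m n : ℕ) : Matrix (Fin n → Fin m) (Fin n → Fin m) ℂ →ₗ[ℂ] ℂ :=
  ((m : ℂ) ^ n)⁻¹ • Matrix.traceLinearMap (Fin n → Fin m) ℂ ℂ

theorem normTrace_apply (n : ℕ) (x : Matrix (Fin n → Fin m) (Fin n → Fin m) ℂ) :
    normTrace m n x = ((m : ℂ) ^ n)⁻¹ * x.trace := rfl

theorem normTrace_mul_comm (n : ℕ) (x y : Matrix (Fin n → Fin m) (Fin n → Fin m) ℂ) :
    normTrace m n (x * y) = normTrace m n (y * x) := by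
  rw [normTrace_apply, normTrace_apply, Matrix.trace_mul_comm]

theorem normTrace_one (hm : m ≠ 0) (n : ℕ) : normTrace m n 1 = 1 := by
  rw [normTrace_apply, Matrix.trace_one]
  simp [hm]

/-- This is the Markov property of the trace, automatic for local representations by
`trace_mul_matrix`; only the value of the constant depends on U. -/
theorem normTrace_mul_localGen (hm : m ≠ 0) {n j : ℕ} (hj : j < n - 1)
    {x : Matrix (Fin n → Fin m) (Fin n → Fin m) ℂ}
    (hx : x ∈ initialAlg (localGen U n) (j - 1)) :
    normTrace m n (x * localGen U n j) = U.trace / (m : ℂ) ^ 2 * normTrace m n x := by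
  have hc := commute_localGen_sub_one hj hx
  have h := trace_mul_matrix (promoteHom (α := Fin m) (adjacent ⟨j, hj⟩)) (normTrace m n)
    (normTrace_mul_comm (m := m) n) hc U
  have hm' : (m : ℂ) ≠ 0 := Nat.cast_ne_zero.2 hm
  rw [promoteHom_apply, ← localGen_of_lt hj] at h
  simp only [Fintype.card_pi, Fintype.card_fin, Finset.prod_const, Finset.card_univ,
    Nat.cast_pow] at h
  field_simp
  linear_combination h

/-- The trace of the Jones-Wenzl element on `j` strands, normalized to take the values `Δ_j(d)` for
the Markov trace. -/
noncomputable def jwTrace (D : ℕ → ℂ) (d : ℂ) (U : Matrix (Fin 2 → Fin m) (Fin 2 → Fin m) ℂ)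
    (n : ℕ) : ℕ → ℂ
  -- This value makes the recursion valid from its first step.
  | 0 => 1
  | j + 1 => d ^ (j + 1) * normTrace m n (jwSeq D (localGen U n) j)

theorem jwTrace_one (hm : m ≠ 0) (n : ℕ) : jwTrace D d U n 1 = d := by
  simp [jwTrace, jwSeq, normTrace_one hm]

/-- The trace recursion combined with the Markov property. The coefficient of the last term is 1
exactly when the Markov constant is 1/d, and then this is the recursion of Δ. -/
theorem IsTLSeq.jwTrace_step {n j : ℕ} (hT : IsTLSeq d (n - 1) (localGen U n))
    (hD : IsChebSeq d D) (hm : m ≠ 0) (hd : d ≠ 0) (hj : j + 1 < n) (hD0 : ∀ i ≤ j + 1, D i ≠ 0) :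
    jwTrace D d U n (j + 2) = d * jwTrace D d U n (j + 1) -
      (d * (U.trace / (m : ℂ) ^ 2)) * jwTrace D d U n j := by
  rcases j with _ | j
  · have h := trace_jwSeq_one (u := localGen U n) hD (normTrace m n)
    have h2 := normTrace_mul_localGen (U := U) hm (n := n) (j := 0) (by omega) (one_mem _)
    rw [one_mul, normTrace_one hm] at h2
    rw [normTrace_one hm, h2] at h
    simp only [jwTrace, h]
    simp only [jwSeq, normTrace_one hm]
    field_simp
    ring
  · have h := hT.trace_jwSeq_add_two hD (normTrace m n) (normTrace_mul_comm n) hd (m := j)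
      (by omega) hD0
    have h2 := normTrace_mul_localGen (U := U) hm (n := n) (j := j + 1) (by omega)
      (x := jwSeq D (localGen U n) j) (jwSeq_mem j)
    rw [h2] at h
    simp only [jwTrace, h]
    field_simp
    ring

end

/-! ### The algebras TLJ and the Jones representation -/

theorem isChebSeq_chebDelta (A : ℂˣ) : IsChebSeq (loopVar A) (chebDelta A) where
  zero := by simp [chebDelta]
  one := by simp [chebDelta]
  step m := by
    have := congrArg (Polynomial.eval (loopVar A)) (Polynomial.Chebyshev.S_add_two ℂ (m : ℤ))
    simpa only [chebDelta, Nat.cast_add, Nat.cast_ofNat, Nat.cast_one, Polynomial.eval_sub,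
      Polynomial.eval_mul, Polynomial.eval_X] using this

/-- The generators of `TLJ_n(A)`, extended by zero. -/
noncomputable def tljGen (k : ℕ) (A : ℂˣ) (n j : ℕ) : TLJ k A n :=
  if h : j < n - 1 then TLJ.u k A ⟨j, h⟩ else 0

section
variable {k : ℕ} {A : ℂˣ} {n : ℕ}

theorem tljGen_of_lt {j : ℕ} (h : j < n - 1) : tljGen k A n j = TLJ.u k A ⟨j, h⟩ := dif_pos h

theorem tljGen_val (i : Fin (n - 1)) : tljGen k A n i = TLJ.u k A i := tljGen_of_lt i.2

theorem isTLSeq_tljGen : IsTLSeq (loopVar A) (n - 1) (tljGen k A n) where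
  sq i hi := by rw [tljGen_of_lt hi, TLJ.u_sq]
  far i j h hj := by
    rw [tljGen_of_lt hj, tljGen_of_lt (by omega)]
    exact TLJ.u_far k A _ _ h
  up i hi := by
    rw [tljGen_of_lt hi, tljGen_of_lt (by omega)]
    exact TLJ.u_adj k A _ _ (Or.inl rfl)
  down i hi := by
    rw [tljGen_of_lt hi, tljGen_of_lt (by omega)]
    exact TLJ.u_adj k A _ _ (Or.inr rfl)

theorem tljMk_jonesWenzl {m : ℕ} (h : m < n) :
    TLJ.mk k A n (TL.jonesWenzl A n m h) = jwSeq (chebDelta A) (tljGen k A n) m := by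
  induction m with
  | zero => simp [TL.jonesWenzl, jwSeq]
  | succ m ih =>
    simp only [TL.jonesWenzl, jwSeq, map_sub, map_smul, map_mul, ih (Nat.lt_of_succ_lt h)]
    rw [tljGen_of_lt (Nat.lt_sub_of_add_lt h)]
    rfl

theorem jwSeq_tljGen_eq_zero (h : k < n) : jwSeq (chebDelta A) (tljGen k A n) k = 0 := by
  rw [← tljMk_jonesWenzl h]
  exact (RingQuot.mkAlgHom_rel ℂ (TLJRel.jw h)).trans (map_zero (TLJ.mk k A n))

theorem tljMk_surjective : Function.Surjective (TLJ.mk k A n) :=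
  RingQuot.mkAlgHom_surjective ℂ (TLJRel k A n)

theorem tlMk_surjective : Function.Surjective (TL.mk A n) :=
  RingQuot.mkAlgHom_surjective ℂ (TLRel A n)

theorem mem_of_tljGen_mem {S : Subalgebra ℂ (TLJ k A n)}
    (hS : ∀ i : Fin (n - 1), TLJ.u k A i ∈ S) (x : TLJ k A n) : x ∈ S := by
  obtain ⟨y, rfl⟩ := tljMk_surjective x
  obtain ⟨z, rfl⟩ := tlMk_surjective y
  induction z using FreeAlgebra.induction with
  | grade0 r =>
    rw [AlgHom.commutes, AlgHom.commutes]
    exact S.algebraMap_mem r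
  | grade1 i => exact hS i
  | mul a b ha hb => rw [map_mul, map_mul]; exact mul_mem ha hb
  | add a b ha hb => rw [map_add, map_add]; exact add_mem ha hb

theorem mem_initialAlg_tljGen (x : TLJ k A n) : x ∈ initialAlg (tljGen k A n) (n - 1) :=
  mem_of_tljGen_mem (fun i => tljGen_val (k := k) (A := A) i ▸ gen_mem_initialAlg i.2) x

/-- A Temperley-Lieb sequence of length `n - 1` whose `k`-th Jones-Wenzl element vanishes is a
representation of `TLJ_n(A)`. -/
theorem exists_tljLift {C : Type*} [Ring C] [Algebra ℂ C] {v : ℕ → C}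
    (hv : IsTLSeq (loopVar A) (n - 1) v) (hk : k < n → jwSeq (chebDelta A) v k = 0) :
    ∃ φ : TLJ k A n →ₐ[ℂ] C, ∀ i : Fin (n - 1), φ (TLJ.u k A i) = v i := by
  let f : FreeAlgebra ℂ (Fin (n - 1)) →ₐ[ℂ] C := FreeAlgebra.lift ℂ fun i => v i
  have hf : ∀ i, f (FreeAlgebra.ι ℂ i) = v i := fun i => FreeAlgebra.lift_ι_apply _ i
  have hrel : ∀ ⦃x y⦄, TLRel A n x y → f x = f y := by
    rintro _ _ (⟨i⟩ | ⟨i, j, h⟩ | ⟨i, j, h⟩)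
    · rw [map_mul, map_smul, hf, hv.sq i i.2]
    · rw [map_mul, map_mul, hf, hf, hv.far i j h j.2]
    · rw [map_mul, map_mul, hf, hf]
      rcases h with h | h
      · have := hv.up i (by omega)
        rwa [← h] at this
      · have := hv.down j (by omega)
        rwa [← h] at this
  let g : TL A n →ₐ[ℂ] C := RingQuot.liftAlgHom ℂ ⟨f, hrel⟩
  have hg : ∀ i, g (TL.u A i) = v i := fun i =>
    (RingQuot.liftAlgHom_mkAlgHom_apply ℂ f hrel _).trans (hf i)
  have hgJ : ∀ m (h : m < n), g (TL.jonesWenzl A n m h) = jwSeq (chebDelta A) v m := by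
    intro m h
    induction m with
    | zero => simp [TL.jonesWenzl, jwSeq]
    | succ m ih =>
      simp only [TL.jonesWenzl, jwSeq, map_sub, map_smul, map_mul, ih (Nat.lt_of_succ_lt h), hg]
  have hrel2 : ∀ ⦃x y⦄, TLJRel k A n x y → g x = g y := by
    rintro _ _ ⟨h⟩
    rw [hgJ, hk h, map_zero]
  exact ⟨RingQuot.liftAlgHom ℂ ⟨g, hrel2⟩, fun i =>
    (RingQuot.liftAlgHom_mkAlgHom_apply ℂ g hrel2 _).trans (hg i)⟩

theorem BraidGroup.lift_σ {G : Type*} [Group G] (s : Fin (n - 1) → G)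
    (far : ∀ i j : Fin (n - 1), i.val + 2 ≤ j.val → s i * s j = s j * s i)
    (braid : ∀ i j : Fin (n - 1), j.val = i.val + 1 → s i * s j * s i = s j * s i * s j)
    (i : Fin (n - 1)) : BraidGroup.lift s far braid (BraidGroup.σ i) = s i := by
  unfold BraidGroup.lift BraidGroup.σ
  exact PresentedGroup.toGroup.of _

theorem jonesRep_σ (i : Fin (n - 1)) : jonesRep k A n (BraidGroup.σ i) =
    (A : ℂ) • 1 + ((A⁻¹ : ℂˣ) : ℂ) • TLJ.u k A i := by
  simp only [jonesRep, MonoidHom.comp_apply, BraidGroup.lift_σ]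
  rfl

/-- Solving the Kauffman bracket for `u_i` shows that the braid group generates all of TLJ, and
which matrix a localization must assign to `u_i`. -/
theorem u_eq_jonesRep (i : Fin (n - 1)) : TLJ.u k A i =
    (A : ℂ) • jonesRep k A n (BraidGroup.σ i) - ((A : ℂ) ^ 2) • 1 := by
  rw [jonesRep_σ, smul_add, smul_smul, smul_smul, Units.mul_inv, one_smul, sq]
  abel

theorem rep_σ {m : ℕ} (W : UnitaryRMatrix m) (i : Fin (n - 1)) :
    (W.rep n (BraidGroup.σ i)).val = promote (adjacent i) W.R := by
  rw [UnitaryRMatrix.rep, BraidGroup.lift_σ]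
  rfl

theorem imageAlgebra_jonesRep : imageAlgebra (jonesRep k A n) = ⊤ := by
  rw [eq_top_iff]
  refine fun x _ => mem_of_tljGen_mem (fun i => ?_) x
  rw [u_eq_jonesRep]
  exact sub_mem (Subalgebra.smul_mem _ (Algebra.subset_adjoin (Set.mem_range_self _)) _)
    (Subalgebra.smul_mem _ (one_mem _) _)

/-- A localization gives a faithful local representation of the algebras `TLJ_n(A)`. -/
theorem exists_hom_of_isLocalizedBy {m : ℕ} {W : UnitaryRMatrix m}
    (h : IsLocalizedBy (jonesRep k A) W) (hn : 2 ≤ n) :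
    ∃ φ : TLJ k A n →ₐ[ℂ] Matrix (Fin n → Fin m) (Fin n → Fin m) ℂ, Function.Injective φ ∧
      ∀ j, φ (tljGen k A n j) = localGen ((A : ℂ) • W.R - ((A : ℂ) ^ 2) • 1) n j := by
  obtain ⟨ψ, hψ, hb⟩ := h n hn
  let e : TLJ k A n →ₐ[ℂ] imageAlgebra (jonesRep k A n) :=
    (Subalgebra.inclusion imageAlgebra_jonesRep.ge).comp Subalgebra.topEquiv.symm.toAlgHom
  refine ⟨ψ.comp e, hψ.comp fun x y hxy => congrArg Subtype.val hxy, fun j => ?_⟩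
  by_cases hj : j < n - 1
  · have he : e (jonesRep k A n (BraidGroup.σ ⟨j, hj⟩)) =
      ⟨jonesRep k A n (BraidGroup.σ ⟨j, hj⟩), Algebra.subset_adjoin ⟨_, rfl⟩⟩ := rfl
    rw [tljGen_of_lt hj, localGen_of_lt hj, u_eq_jonesRep, map_sub, map_smul, map_smul, map_one,
      AlgHom.comp_apply, he, hb, rep_σ, ← promoteHom_apply, ← promoteHom_apply, map_sub, map_smul,
      map_smul, map_one]
  · rw [tljGen, localGen, dif_neg hj, dif_neg hj, map_zero]

/-- At level at least 2 no Jones-Wenzl relation is imposed on two strands, so `u ↦ 0` defines a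
character. This rules out localization on the zero space. -/
theorem nontrivial_tlj_two (hk : 2 ≤ k) : Nontrivial (TLJ k A 2) := by
  obtain ⟨φ, -⟩ := exists_tljLift (k := k) (A := A) (n := 2) (v := fun _ => (0 : ℂ))
    ⟨by simp, by simp, by simp, by simp⟩ (fun h => absurd h (by omega))
  exact φ.toRingHom.domain_nontrivial

end

/-! ### Necessity: rationality of d² and Niven's theorem -/

/-- A positive solution of a perturbed Chebyshev recursion that vanishes where the unperturbed one
first does belongs to the unperturbed recursion. -/
theorem perturbation_eq_one {v s : ℕ → ℝ} {d κ : ℝ} {k : ℕ} (hk : 1 ≤ k)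
    (hv0 : v 0 = 1) (hv1 : v 1 = d) (hs0 : s 0 = 1) (hs1 : s 1 = d)
    (hv : ∀ j < k, v (j + 2) = d * v (j + 1) - κ * v j)
    (hs : ∀ j, s (j + 2) = d * s (j + 1) - s j)
    (hvpos : ∀ j ≤ k, 0 ≤ v j) (hspos : ∀ j ≤ k, 0 < s j)
    (hvk : v (k + 1) = 0) (hsk : s (k + 1) = 0) : κ = 1 := by
  -- The discrete Wronskian of the two solutions, summed up. It vanishes at k, whereas the sum on
  -- the right is positive, already by its term i = 0.
  have main : ∀ j ≤ k, v (j + 1) * s j - v j * s (j + 1) =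
      (1 - κ) * ∑ i ∈ Finset.range j, v i * s (i + 1) := by
    intro j hj
    induction j with
    | zero => simp [hv0, hv1, hs0, hs1]
    | succ j ih =>
      rw [Finset.sum_range_succ, mul_add, ← ih (by omega), hv j (by omega), hs]
      ring
  have h := main k le_rfl
  rw [hvk, hsk, zero_mul, mul_zero, sub_zero] at h
  have hpos : 0 < ∑ i ∈ Finset.range k, v i * s (i + 1) := by
    refine Finset.sum_pos' (fun i hi => ?_) ⟨0, Finset.mem_range.2 hk, ?_⟩
    · rw [Finset.mem_range] at hi
      exact mul_nonneg (hvpos i hi.le) (hspos _ hi).le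
    · rw [hv0, one_mul]; exact hspos 1 hk
  rcases mul_eq_zero.1 h.symm with h | h
  · linarith
  · exact absurd h hpos.ne'

section
variable {k : ℕ} {ε δ : ℤˣ}

theorem kauffmanVar_sq (k : ℕ) (ε δ : ℤˣ) : ((kauffmanVar k ε δ : ℂˣ) : ℂ) ^ 2 =
    -Complex.exp (((δ : ℤ) : ℂ) * ((Real.pi / (k + 2) : ℝ) : ℂ) * Complex.I) := by
  have hk : (k : ℂ) + 2 ≠ 0 := by exact_mod_cast (by omega : k + 2 ≠ 0)
  have hε : (((ε : ℤ) : ℂ)) ^ 2 = 1 := by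
    rcases Int.units_eq_one_or ε with rfl | rfl <;> simp
  rw [kauffmanVar, Units.val_mk0, mul_pow, mul_pow, hε, Complex.I_sq, ← Complex.exp_nat_mul,
    one_mul, neg_one_mul]
  congr 2
  push_cast
  field_simp
  ring

theorem loopVar_kauffmanVar (k : ℕ) (ε δ : ℤˣ) :
    loopVar (kauffmanVar k ε δ) = ((2 * Real.cos (Real.pi / (k + 2)) : ℝ) : ℂ) := by
  rw [loopVar, Units.val_inv_eq_inv_val, inv_pow, kauffmanVar_sq, inv_neg, ← Complex.exp_neg,
    Complex.ofReal_mul, Complex.ofReal_cos, Complex.cos]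
  push_cast
  rcases Int.units_eq_one_or δ with rfl | rfl
  · simp [neg_mul]; ring
  · simp [neg_mul]; ring

theorem sin_level_pos {j : ℕ} (hj : j ≤ k) :
    0 < Real.sin ((j + 1 : ℝ) * (Real.pi / (k + 2))) := by
  have hj' : (j : ℝ) ≤ k := by exact_mod_cast hj
  have hj0 : (0 : ℝ) ≤ j := j.cast_nonneg
  refine Real.sin_pos_of_pos_of_lt_pi (by positivity) ?_
  rw [← mul_div_assoc, div_lt_iff₀ (by linarith), mul_comm]
  exact mul_lt_mul_of_pos_left (by linarith) Real.pi_pos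

/-- `Δ_j(d)` as a real number. -/
noncomputable def levelDelta (k j : ℕ) : ℝ :=
  Real.sin ((j + 1 : ℝ) * (Real.pi / (k + 2))) / Real.sin (Real.pi / (k + 2))

theorem chebDelta_kauffmanVar (j : ℕ) :
    chebDelta (kauffmanVar k ε δ) j = (levelDelta k j : ℂ) := by
  have h0 : Real.sin (Real.pi / (k + 2)) ≠ 0 := by
    simpa using (sin_level_pos (k := k) (Nat.zero_le k)).ne'
  have h := Polynomial.Chebyshev.S_two_mul_complex_cos ((Real.pi / (k + 2) : ℝ) : ℂ) (j : ℤ)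
  rw [chebDelta, loopVar_kauffmanVar, levelDelta, Complex.ofReal_div, eq_div_iff (by
    exact_mod_cast h0)]
  push_cast at h ⊢
  exact h

theorem levelDelta_pos {j : ℕ} (hj : j ≤ k) : 0 < levelDelta k j :=
  div_pos (sin_level_pos hj) (by simpa using sin_level_pos (k := k) (Nat.zero_le k))

theorem levelDelta_succ_self : levelDelta k (k + 1) = 0 := by
  have : ((k + 1 : ℕ) + 1 : ℝ) * (Real.pi / (k + 2)) = Real.pi := by
    push_cast; field_simp; ring
  rw [levelDelta, this, Real.sin_pi, zero_div]

theorem chebDelta_ne_zero {j : ℕ} (hj : j ≤ k) : chebDelta (kauffmanVar k ε δ) j ≠ 0 := by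
  rw [chebDelta_kauffmanVar]
  exact_mod_cast (levelDelta_pos hj).ne'

/-- The double angle has rational cosine d²/2 - 1, so Niven's theorem allows 2π/(k+2) only the
values 0, π/3, π/2, 2π/3, π; the two extremes are incompatible with k ≥ 1. -/
theorem level_of_sq_rational (hk : 1 ≤ k)
    (h : ∃ q : ℚ, (2 * Real.cos (Real.pi / (k + 2))) ^ 2 = q) : k ∈ ({1, 2, 4} : Set ℕ) := by
  obtain ⟨q, hq⟩ := h
  have hk0 : (0 : ℝ) < k + 2 := by positivity
  have hk1 : (1 : ℝ) ≤ k := by exact_mod_cast hk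
  have h1 : Real.cos (2 * (Real.pi / (k + 2))) = ((q / 2 - 1 : ℚ) : ℝ) := by
    rw [Real.cos_two_mul]; push_cast; linarith
  have h2 := niven_angle_eq (θ := 2 * (Real.pi / (k + 2))) ⟨2 / (k + 2), by push_cast; ring⟩
    ⟨_, h1⟩ ⟨by positivity, by
      rw [← mul_div_assoc, div_le_iff₀ hk0, mul_comm]
      exact mul_le_mul_of_nonneg_left (by linarith) Real.pi_pos.le⟩
  have key : ∀ c : ℝ, 2 * (Real.pi / (k + 2)) = Real.pi * c → 2 = c * (k + 2) := by
    intro c hc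
    field_simp at hc
    linarith
  simp only [Set.mem_insert_iff, Set.mem_singleton_iff] at h2 ⊢
  rcases h2 with h | h | h | h | h
  · have := key 0 (by rw [h, mul_zero]); linarith
  · have := key (1 / 3) (by rw [h]; ring)
    right; right
    have : (k : ℝ) = 4 := by linarith
    exact_mod_cast this
  · have := key (1 / 2) (by rw [h]; ring)
    right; left
    have : (k : ℝ) = 2 := by linarith
    exact_mod_cast this
  · have := key (2 / 3) h
    left
    have : (k : ℝ) = 1 := by linarith
    exact_mod_cast this
  · have := key 1 (by rw [h, mul_one]); linarith

theorem level_of_localizable (hk : 1 ≤ k) (h : Localizable (jonesRep k (kauffmanVar k ε δ))) :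
    k ∈ ({1, 2, 4} : Set ℕ) := by
  rcases hk.eq_or_lt with rfl | hk2
  · simp
  obtain ⟨m, W, hW⟩ := h
  set A := kauffmanVar k ε δ with hA
  have hm : m ≠ 0 := by
    rintro rfl
    obtain ⟨φ, hφ, -⟩ := exists_hom_of_isLocalizedBy hW le_rfl
    have := nontrivial_tlj_two (A := A) hk2
    exact not_subsingleton _ (hφ.subsingleton)
  -- The least number of strands on which p_{k+1} exists. Only the homomorphism is needed from here
  -- on; its injectivity served to get m ≠ 0.
  obtain ⟨φ, -, hφ⟩ := exists_hom_of_isLocalizedBy hW (n := k + 1) (by omega)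
  set U := (A : ℂ) • W.R - ((A : ℂ) ^ 2) • 1
  set d : ℝ := 2 * Real.cos (Real.pi / (k + 2)) with hd_def
  have hdA : loopVar A = d := loopVar_kauffmanVar k ε δ
  have hT : IsTLSeq (d : ℂ) (k + 1 - 1) (localGen U (k + 1)) := by
    have := (isTLSeq_tljGen (k := k) (A := A) (n := k + 1)).map φ
    rwa [funext hφ, hdA] at this
  have hD : IsChebSeq (d : ℂ) (chebDelta A) := hdA ▸ isChebSeq_chebDelta A
  have hD0 : ∀ i ≤ k, chebDelta A i ≠ 0 := fun i hi => chebDelta_ne_zero hi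
  have hs : ∀ j, chebDelta A j = (levelDelta k j : ℂ) := fun j => chebDelta_kauffmanVar j
  have hs0 : levelDelta k 0 = 1 := by exact_mod_cast (hs 0).symm.trans hD.zero
  have hs1 : levelDelta k 1 = d := by exact_mod_cast (hs 1).symm.trans hD.one
  have hstep : ∀ j, levelDelta k (j + 2) = d * levelDelta k (j + 1) - levelDelta k j := by
    intro j
    have := hD.step j
    rw [hs, hs, hs] at this
    exact_mod_cast this
  have hdpos : 0 < d := hs1 ▸ levelDelta_pos hk
  have hd0 : (d : ℂ) ≠ 0 := by exact_mod_cast hdpos.ne'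
  have hmn : (0 : ℝ) < (m : ℝ) ^ (k + 1) := by positivity
  have hJ : jwSeq (chebDelta A) (localGen U (k + 1)) k = 0 := by
    rw [← funext hφ, ← map_jwSeq, jwSeq_tljGen_eq_zero (by omega), map_zero]
  have hJtr : ∀ j < k, ∃ t : ℕ, (jwSeq (chebDelta A) (localGen U (k + 1)) j).trace = t :=
    fun j hj => exists_nat_trace_of_idem (hT.isJWProj_jwSeq hD j (by omega)
      fun i hi => hD0 i (by omega)).idem
  -- Here t is the rank of the idempotent u_0/d on all k + 1 factors, whence the power of m in κ.
  obtain ⟨t, ht⟩ : ∃ t : ℕ, ((d : ℂ)⁻¹ • localGen U (k + 1) 0).trace = t := by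
    refine exists_nat_trace_of_idem ?_
    rw [smul_mul_smul_comm, hT.sq 0 (by omega), smul_smul]
    congr 1
    field_simp
  have hq : U.trace / (m : ℂ) ^ 2 = ((d * t / (m : ℝ) ^ (k + 1) : ℝ) : ℂ) := by
    have h := normTrace_mul_localGen (U := U) hm (n := k + 1) (j := 0) (by omega) (one_mem _)
    rw [one_mul, normTrace_one hm, mul_one] at h
    rw [← h, normTrace_apply]
    rw [Matrix.trace_smul, smul_eq_mul, inv_mul_eq_iff_eq_mul₀ hd0] at ht
    rw [ht]
    push_cast
    ring
  set κ : ℝ := d * (d * t / (m : ℝ) ^ (k + 1)) with hκ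
  have hvstep : ∀ j, j < k → (jwTrace (chebDelta A) d U (k + 1) (j + 2)).re =
      d * (jwTrace (chebDelta A) d U (k + 1) (j + 1)).re -
        κ * (jwTrace (chebDelta A) d U (k + 1) j).re := by
    intro j hj
    rw [hT.jwTrace_step hD hm hd0 (by omega) fun i hi => hD0 i (by omega), hq,
      ← Complex.ofReal_mul, Complex.sub_re, Complex.re_ofReal_mul, Complex.re_ofReal_mul]
  have hκ1 : κ = 1 := by
    refine perturbation_eq_one (v := fun j => (jwTrace (chebDelta A) d U (k + 1) j).re)
      (s := levelDelta k) hk (by simp [jwTrace]) (by simp [jwTrace_one hm]) hs0 hs1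
      hvstep hstep ?_ (fun j hj => levelDelta_pos hj) (by simp [jwTrace, hJ]) levelDelta_succ_self
    intro j hj
    rcases j with _ | j
    · simp [jwTrace]
    · obtain ⟨t, ht⟩ := hJtr j (by omega)
      have : jwTrace (chebDelta A) d U (k + 1) (j + 1) =
          ((d ^ (j + 1) * (((m : ℝ) ^ (k + 1))⁻¹ * t) : ℝ) : ℂ) := by
        rw [jwTrace, normTrace_apply, ht]
        push_cast
        rfl
      simp only [this, Complex.ofReal_re]
      positivity
  -- κ = 1 reads d² t = m^{k+1}.
  refine level_of_sq_rational hk ⟨(m : ℚ) ^ (k + 1) / t, ?_⟩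
  have ht0 : (t : ℝ) ≠ 0 := by
    intro h
    rw [hκ, h] at hκ1
    simp at hκ1
  push_cast
  rw [eq_div_iff ht0, ← hd_def]
  rw [hκ] at hκ1
  field_simp at hκ1
  linarith

end

/-! ### Sufficiency: faithfulness of local solutions with the Markov trace -/

section
variable {m : ℕ} {A : ℂˣ} {U : Matrix (Fin 2 → Fin m) (Fin 2 → Fin m) ℂ}

theorem map_mem_initialAlg {B C : Type*} [Ring B] [Algebra ℂ B] [Ring C] [Algebra ℂ C]
    (φ : B →ₐ[ℂ] C) {u : ℕ → B} {v : ℕ → C} (h : ∀ i, φ (u i) = v i) {j : ℕ} {x : B}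
    (hx : x ∈ initialAlg u j) : φ x ∈ initialAlg v j := by
  induction hx using Algebra.adjoin_induction with
  | mem z hz =>
    obtain ⟨i, hi, rfl⟩ := hz
    rw [h]; exact gen_mem_initialAlg hi
  | algebraMap r => rw [AlgHom.commutes]; exact Subalgebra.algebraMap_mem _ r
  | add a b _ _ ha hb => rw [map_add]; exact add_mem ha hb
  | mul a b _ _ ha hb => rw [map_mul]; exact mul_mem ha hb

/-- The Kauffman bracket of a Hermitian local Temperley-Lieb solution is a unitary `R`-matrix. -/
theorem IsLocalTL.exists_unitaryRMatrix (hU : IsLocalTL (loopVar A) U) (hH : star U = U)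
    (hA : star (A : ℂ) = ((A⁻¹ : ℂˣ) : ℂ)) :
    ∃ W : UnitaryRMatrix m, W.R = (A : ℂ) • 1 + ((A⁻¹ : ℂˣ) : ℂ) • U := by
  have hA' : star ((A⁻¹ : ℂˣ) : ℂ) = A := by rw [← hA, star_star]
  refine ⟨⟨(A : ℂ) • 1 + ((A⁻¹ : ℂˣ) : ℂ) • U, ?_, ?_⟩, rfl⟩
  · rw [Matrix.mem_unitaryGroup_iff, star_add, star_smul, star_smul, hA, hA', hH, star_one]
    simp only [mul_add, add_mul, smul_mul_smul_comm, one_mul, mul_one, hU.sq, smul_smul]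
    simp only [loopVar, Units.val_inv_eq_inv_val]
    have := A.ne_zero
    match_scalars <;> (field_simp; try ring)
  -- The Yang-Baxter equation is the image of the braid relation between Kauffman crossings. Level 3
  -- is chosen because it imposes no Jones-Wenzl relation on three strands.
  · obtain ⟨φ, hφ⟩ := exists_tljLift (k := 3) (hU.isTLSeq 3) (fun h => absurd h (lt_irrefl 3))
    have hφ' : ∀ i : Fin (3 - 1), φ (kauffmanCrossing 3 A (n := 3) i).val =
        promote (adjacent i) ((A : ℂ) • 1 + ((A⁻¹ : ℂˣ) : ℂ) • U) := by
      intro i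
      rw [← promoteHom_apply, kauffmanCrossing]
      simp only [map_add, map_smul, map_one, hφ, localGen_of_lt i.2, promoteHom_apply]
    have h := kauffmanCrossing_braid 3 A (n := 3) 0 1 rfl
    have h2 := congrArg (fun x => φ (Units.val x)) h
    simpa only [Units.val_mul, map_mul, hφ'] using h2

theorem jwTrace_eq_chebDelta (hU : IsLocalTL (loopVar A) U) (hm : m ≠ 0) (hd : loopVar A ≠ 0)
    (htr : loopVar A * (U.trace / (m : ℂ) ^ 2) = 1) {k n j : ℕ}
    (hD0 : ∀ i ≤ k, chebDelta A i ≠ 0) (hj : j ≤ k + 1) (hjn : j ≤ n) :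
    jwTrace (chebDelta A) (loopVar A) U n j = chebDelta A j := by
  have hD := isChebSeq_chebDelta A
  induction j using Nat.strong_induction_on with
  | h j ih =>
    match j with
    | 0 => rw [jwTrace, hD.zero]
    | 1 => rw [jwTrace_one hm, hD.one]
    | j + 2 =>
      rw [(hU.isTLSeq n).jwTrace_step hD hm hd (by omega) fun i hi => hD0 i (by omega), htr,
        one_mul, ih (j + 1) (by omega) (by omega) (by omega), ih j (by omega) (by omega) (by omega),
        hD.step]

/-- A local Temperley-Lieb solution with the Markov value of the trace localizes the Jones
representation. -/
theorem IsLocalTL.isLocalizedBy (hU : IsLocalTL (loopVar A) U) (hm : m ≠ 0) (hd : loopVar A ≠ 0)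
    (htr : loopVar A * (U.trace / (m : ℂ) ^ 2) = 1) {k : ℕ}
    (hD0 : ∀ i ≤ k, chebDelta A i ≠ 0) (hDk : chebDelta A (k + 1) = 0)
    {W : UnitaryRMatrix m} (hW : W.R = (A : ℂ) • 1 + ((A⁻¹ : ℂˣ) : ℂ) • U) :
    IsLocalizedBy (jonesRep k A) W := by
  intro n hn
  have hD := isChebSeq_chebDelta A
  have hT := hU.isTLSeq n
  have hm' : (m : ℂ) ≠ 0 := Nat.cast_ne_zero.2 hm
  have hU0 : U ≠ 0 := by
    rintro rfl
    simp at htr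
  -- The trace is a multiple of Δ_{k+1}(d) = 0, and an idempotent of trace zero vanishes.
  have hJ : k < n → jwSeq (chebDelta A) (localGen U n) k = 0 := by
    intro hk
    refine eq_zero_of_idem_of_trace (hT.isJWProj_jwSeq hD k (by omega) hD0).idem ?_
    have h := jwTrace_eq_chebDelta hU hm hd htr (n := n) hD0 le_rfl hk
    rw [hDk, jwTrace, normTrace_apply] at h
    simpa [hd, hm'] using h
  obtain ⟨φ, hφ⟩ := exists_tljLift hT hJ
  have hφ' : ∀ j, φ (tljGen k A n j) = localGen U n j := by
    intro j
    by_cases hj : j < n - 1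
    · rw [tljGen_of_lt hj, hφ]
    · rw [tljGen, localGen, dif_neg hj, dif_neg hj, map_zero]
  have hinj : Function.Injective φ := by
    rw [injective_iff_map_eq_zero]
    intro x hx
    refine isTLSeq_tljGen.injOn hD φ k hD0 (fun h => jwSeq_tljGen_eq_zero (by omega)) ?_ ?_
      le_rfl (mem_initialAlg_tljGen x) hx
    · intro j hj hjn h0
      have h := jwTrace_eq_chebDelta hU hm hd htr (n := n) (j := j + 1) hD0 (by omega) (by omega)
      rw [jwTrace, ← funext hφ', ← map_jwSeq, h0, map_zero, mul_zero] at h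
      exact hD0 (j + 1) (by omega) h.symm
    · intro j hj y hy h
      rw [hφ', localGen_of_lt hj, ← promoteHom_apply] at h
      exact eq_zero_of_mul_matrix_eq_zero _ hU0
        (commute_localGen_sub_one hj (map_mem_initialAlg φ hφ' hy)) h
  refine ⟨φ.comp (imageAlgebra (jonesRep k A n)).val, hinj.comp Subtype.val_injective, ?_⟩
  let f : BraidGroup n →* Matrix (Fin n → Fin m) (Fin n → Fin m) ℂ :=
    (φ : TLJ k A n →* _).comp (jonesRep k A n)
  let g : BraidGroup n →* Matrix (Fin n → Fin m) (Fin n → Fin m) ℂ :=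
    (Submonoid.subtype _).comp (W.rep n)
  -- Passing to units makes both targets groups, so agreement on the Artin generators suffices.
  have hfg : f.toHomUnits = g.toHomUnits := by
    refine PresentedGroup.ext fun i => Units.ext ?_
    change φ (jonesRep k A n (BraidGroup.σ i)) = (W.rep n (BraidGroup.σ i)).val
    rw [jonesRep_σ, rep_σ, hW, ← promoteHom_apply]
    simp only [map_add, map_smul, map_one, hφ, localGen_of_lt i.2, promoteHom_apply]
  intro b
  exact congrArg Units.val (DFunLike.congr_fun hfg b)

end

/-! ### Local Temperley-Lieb solutions from phases -/

/-- `m^{-1/2}` times the sum over the classes of `f 0 - f 1` of the rank one operators given by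
the phases `α`. -/
noncomputable def phaseTL {m : ℕ} (α : Fin m → Fin m → ℂ) :
    Matrix (Fin 2 → Fin m) (Fin 2 → Fin m) ℂ :=
  Matrix.of fun f g => if f 0 - f 1 = g 0 - g 1 then
    ((Real.sqrt m : ℝ) : ℂ)⁻¹ * (α (f 0) (f 1) * star (α (g 0) (g 1))) else 0

section
variable {m : ℕ} {M : Matrix (Fin 2 → Fin m) (Fin 2 → Fin m) ℂ} {α : Fin m → Fin m → ℂ}

theorem phaseTL_apply_cons (a b c e : Fin m) : phaseTL α ![a, b] ![c, e] =
    if a - b = c - e then ((Real.sqrt m : ℝ) : ℂ)⁻¹ * (α a b * star (α c e)) else 0 := rfl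

theorem promote_zero_apply (f g : Fin 3 → Fin m) :
    promote (adjacent (n := 3) 0) M f g =
      if f 2 = g 2 then M ![f 0, f 1] ![g 0, g 1] else 0 := by
  have h : ∀ f : Fin 3 → Fin m, (fun i => f (adjacent (n := 3) 0 i)) = ![f 0, f 1] := by
    intro f; funext i; fin_cases i <;> rfl
  simp only [promote, Matrix.of_apply, h]
  congr 1
  refine propext ⟨fun H => H 2 fun i => ?_, fun H j hj => ?_⟩
  · fin_cases i <;> exact (by decide)
  · fin_cases j
    · exact absurd rfl (hj 0)
    · exact absurd rfl (hj 1)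
    · exact H

theorem promote_one_apply (f g : Fin 3 → Fin m) :
    promote (adjacent (n := 3) 1) M f g =
      if f 0 = g 0 then M ![f 1, f 2] ![g 1, g 2] else 0 := by
  have h : ∀ f : Fin 3 → Fin m, (fun i => f (adjacent (n := 3) 1 i)) = ![f 1, f 2] := by
    intro f; funext i; fin_cases i <;> rfl
  simp only [promote, Matrix.of_apply, h]
  congr 1
  refine propext ⟨fun H => H 0 fun i => ?_, fun H j hj => ?_⟩
  · fin_cases i <;> exact (by decide)
  · fin_cases j
    · exact H
    · exact absurd rfl (hj 0)
    · exact absurd rfl (hj 1)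

theorem star_phaseTL : star (phaseTL α) = phaseTL α := by
  ext f g
  simp only [Matrix.star_apply, phaseTL, Matrix.of_apply, eq_comm (a := g 0 - g 1)]
  split_ifs
  · simp [mul_comm]
  · simp

variable [NeZero m]

theorem add_sub_eq_of_sub_eq_sub {G : Type*} [AddCommGroup G] {a b c e : G} (h : a - b = c - e) :
    b + (c - a) = e := by
  rw [sub_eq_sub_iff_add_eq_add] at h
  rw [← add_sub_assoc, sub_eq_iff_eq_add, add_comm b, ← h, add_comm]

/-- The pairs with a given difference form one orbit of simultaneous translation, so the sum over
all pairs reduces to a sum over translations s. The two versions on three factors rest on the same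
reindexing. -/
theorem phaseTL_mul_apply {p : Type*} [Fintype p] (N : Matrix (Fin 2 → Fin m) p ℂ)
    (f : Fin 2 → Fin m) (g : p) : (phaseTL α * N) f g =
      ∑ s, ((Real.sqrt m : ℝ) : ℂ)⁻¹ * (α (f 0) (f 1) * star (α (f 0 + s) (f 1 + s))) *
        N ![f 0 + s, f 1 + s] g := by
  rw [Matrix.mul_apply]
  symm
  refine Finset.sum_of_injOn (fun s => ![f 0 + s, f 1 + s]) ?_ (by simp) ?_ ?_
  · intro s _ t _ h
    exact add_left_cancel (congrFun h 0)
  · intro h _ hh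
    simp only [phaseTL, Matrix.of_apply]
    rw [if_neg, zero_mul]
    intro hcl
    refine hh ⟨h 0 - f 0, by simp, ?_⟩
    funext i
    fin_cases i
    · simp
    · exact add_sub_eq_of_sub_eq_sub hcl
  · intro s _
    simp [phaseTL]

theorem promote_zero_mul_apply (N : Matrix (Fin 3 → Fin m) (Fin 3 → Fin m) ℂ)
    (f g : Fin 3 → Fin m) : (promote (adjacent (n := 3) 0) (phaseTL α) * N) f g =
      ∑ s, ((Real.sqrt m : ℝ) : ℂ)⁻¹ * (α (f 0) (f 1) * star (α (f 0 + s) (f 1 + s))) *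
        N ![f 0 + s, f 1 + s, f 2] g := by
  rw [Matrix.mul_apply]
  symm
  refine Finset.sum_of_injOn (fun s => ![f 0 + s, f 1 + s, f 2]) ?_ (by simp) ?_ ?_
  · intro s _ t _ h
    exact add_left_cancel (congrFun h 0)
  · intro h _ hh
    rw [promote_zero_apply]
    split_ifs with h2
    · simp only [phaseTL, Matrix.of_apply]
      rw [if_neg, zero_mul]
      intro hcl
      refine hh ⟨h 0 - f 0, by simp, ?_⟩
      funext i
      fin_cases i
      · simp
      · exact add_sub_eq_of_sub_eq_sub hcl
      · exact h2
    · rw [zero_mul]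
  · intro s _
    simp [promote_zero_apply, phaseTL]

theorem promote_one_mul_apply (N : Matrix (Fin 3 → Fin m) (Fin 3 → Fin m) ℂ)
    (f g : Fin 3 → Fin m) : (promote (adjacent (n := 3) 1) (phaseTL α) * N) f g =
      ∑ s, ((Real.sqrt m : ℝ) : ℂ)⁻¹ * (α (f 1) (f 2) * star (α (f 1 + s) (f 2 + s))) *
        N ![f 0, f 1 + s, f 2 + s] g := by
  rw [Matrix.mul_apply]
  symm
  refine Finset.sum_of_injOn (fun s => ![f 0, f 1 + s, f 2 + s]) ?_ (by simp) ?_ ?_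
  · intro s _ t _ h
    exact add_left_cancel (congrFun h 1)
  · intro h _ hh
    rw [promote_one_apply]
    split_ifs with h2
    · simp only [phaseTL, Matrix.of_apply]
      rw [if_neg, zero_mul]
      intro hcl
      refine hh ⟨h 1 - f 1, by simp, ?_⟩
      funext i
      fin_cases i
      · exact h2
      · simp
      · exact add_sub_eq_of_sub_eq_sub hcl
    · rw [zero_mul]
  · intro s _
    simp [promote_one_apply, phaseTL]

theorem sqrt_natCast_sq (m : ℕ) : ((Real.sqrt m : ℝ) : ℂ) * ((Real.sqrt m : ℝ) : ℂ) = m := by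
  exact_mod_cast Real.mul_self_sqrt (Nat.cast_nonneg m)

theorem sqrt_natCast_ne_zero : ((Real.sqrt m : ℝ) : ℂ) ≠ 0 := by
  have : (0 : ℝ) < m := by exact_mod_cast Nat.pos_of_ne_zero (NeZero.ne m)
  exact_mod_cast (Real.sqrt_pos.2 this).ne'

/-- All m² diagonal entries equal m^{-1/2}; this is the condition κ = 1 for d = √m. -/
theorem trace_phaseTL (hα : ∀ a b, α a b * star (α a b) = 1) :
    ((Real.sqrt m : ℝ) : ℂ) * ((phaseTL α).trace / (m : ℂ) ^ 2) = 1 := by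
  have hm : (m : ℂ) ≠ 0 := Nat.cast_ne_zero.2 (NeZero.ne m)
  have h := sqrt_natCast_ne_zero (m := m)
  simp only [Matrix.trace, Matrix.diag_apply, phaseTL, Matrix.of_apply, if_true, hα]
  simp
  field_simp

/-- The phases `α` give a local Temperley-Lieb solution if the sums over nontrivial two-step moves
cancel. -/
theorem isLocalTL_phaseTL (hα : ∀ a b, α a b * star (α a b) = 1)
    (hup : ∀ a b c t, t ≠ 0 → ∑ s, star (α (a + s) (b + s)) * α (b + s) c *
      star (α (b + s + t) (c + t)) * α (a + s) (b + s + t) = 0)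
    (hdown : ∀ a b c t, t ≠ 0 → ∑ s, star (α (b + s) (c + s)) * α a (b + s) *
      star (α (a + t) (b + s + t)) * α (b + s + t) (c + s) = 0) :
    IsLocalTL ((Real.sqrt m : ℝ) : ℂ) (phaseTL α) := by
  have hr := sqrt_natCast_sq m
  have hr0 := sqrt_natCast_ne_zero (m := m)
  set r := ((Real.sqrt m : ℝ) : ℂ) with hr_def
  have hα' : ∀ a b, star (α a b) * α a b = 1 := fun a b => by rw [mul_comm, hα]
  refine ⟨?_, ?_, ?_⟩
  · ext f g
    rw [phaseTL_mul_apply]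
    simp only [phaseTL, Matrix.of_apply, Matrix.smul_apply, smul_eq_mul, ← hr_def,
      Matrix.cons_val_zero, Matrix.cons_val_one, add_sub_add_right_eq_sub]
    split_ifs
    · have : ∀ s, r⁻¹ * (α (f 0) (f 1) * star (α (f 0 + s) (f 1 + s))) *
          (r⁻¹ * (α (f 0 + s) (f 1 + s) * star (α (g 0) (g 1)))) =
          r⁻¹ * r⁻¹ * (α (f 0) (f 1) * star (α (g 0) (g 1))) := by
        intro s
        linear_combination (r⁻¹ * r⁻¹ * α (f 0) (f 1) * star (α (g 0) (g 1))) *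
          hα' (f 0 + s) (f 1 + s)
      simp only [this, Finset.sum_const, Finset.card_univ, Fintype.card_fin, nsmul_eq_mul, ← hr]
      field_simp
    · simp
  · ext f g
    rw [mul_assoc, promote_zero_mul_apply]
    simp only [promote_one_mul_apply, promote_zero_apply]
    simp only [phaseTL_apply_cons,
      Matrix.cons_val_zero, Matrix.cons_val_one, Matrix.cons_val, ← hr_def]
    have e : ∀ s t : Fin m, f 0 + s - (f 1 + s + t) = f 0 - f 1 - t := fun s t => by abel
    simp only [e, Finset.mul_sum]
    -- The first pair is translated by s, the second by t. For t = 0 the phases cancel and the m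
    -- equal terms give m · m^{-3/2} = m^{-1/2}; for t ≠ 0 the sum over s vanishes by `hup`.
    rw [Finset.sum_comm, Finset.sum_eq_single 0]
    · simp only [add_zero, sub_zero]
      split_ifs
      · have : ∀ s, r⁻¹ * (α (f 0) (f 1) * star (α (f 0 + s) (f 1 + s))) *
            (r⁻¹ * (α (f 1 + s) (f 2) * star (α (f 1 + s) (f 2))) *
              (r⁻¹ * (α (f 0 + s) (f 1 + s) * star (α (g 0) (g 1))))) =
            r⁻¹ * r⁻¹ * r⁻¹ * (α (f 0) (f 1) * star (α (g 0) (g 1))) := by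
          intro s
          rw [hα]
          linear_combination (r⁻¹ * r⁻¹ * r⁻¹ * α (f 0) (f 1) * star (α (g 0) (g 1))) *
            hα' (f 0 + s) (f 1 + s)
        simp only [this, Finset.sum_const, Finset.card_univ, Fintype.card_fin, nsmul_eq_mul, ← hr]
        field_simp
      · simp
      · simp
    · intro t _ ht
      split_ifs
      · have h := hup (f 0) (f 1) (f 2) t ht
        rw [← mul_zero (r⁻¹ * r⁻¹ * r⁻¹ * (α (f 0) (f 1) * star (α (g 0) (g 1)))), ← h,
          Finset.mul_sum]
        exact Finset.sum_congr rfl fun s _ => by ring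
      · simp
      · simp
    · simp
  · ext f g
    rw [mul_assoc, promote_one_mul_apply]
    simp only [promote_zero_mul_apply, promote_one_apply]
    simp only [phaseTL_apply_cons,
      Matrix.cons_val_zero, Matrix.cons_val_one, Matrix.cons_val, ← hr_def]
    have e : ∀ s t : Fin m, f 1 + s + t - (f 2 + s) = f 1 - f 2 + t := fun s t => by abel
    simp only [e, Finset.mul_sum]
    rw [Finset.sum_comm, Finset.sum_eq_single 0]
    · simp only [add_zero]
      split_ifs
      · have : ∀ s, r⁻¹ * (α (f 1) (f 2) * star (α (f 1 + s) (f 2 + s))) *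
            (r⁻¹ * (α (f 0) (f 1 + s) * star (α (f 0) (f 1 + s))) *
              (r⁻¹ * (α (f 1 + s) (f 2 + s) * star (α (g 1) (g 2))))) =
            r⁻¹ * r⁻¹ * r⁻¹ * (α (f 1) (f 2) * star (α (g 1) (g 2))) := by
          intro s
          rw [hα]
          linear_combination (r⁻¹ * r⁻¹ * r⁻¹ * α (f 1) (f 2) * star (α (g 1) (g 2))) *
            hα' (f 1 + s) (f 2 + s)
        simp only [this, Finset.sum_const, Finset.card_univ, Fintype.card_fin, nsmul_eq_mul, ← hr]
        field_simp
      · simp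
      · simp
    · intro t _ ht
      split_ifs
      · have h := hdown (f 0) (f 1) (f 2) t ht
        rw [← mul_zero (r⁻¹ * r⁻¹ * r⁻¹ * (α (f 1) (f 2) * star (α (g 1) (g 2)))), ← h,
          Finset.mul_sum]
        exact Finset.sum_congr rfl fun s _ => by ring
      · simp
      · simp
    · simp

end

/-! ### Roots of unity as phases and the explicit exponents -/

/-- The phases given by powers of a primitive `N`-th root of unity. -/
noncomputable def charPhase {m N : ℕ} [NeZero N] (q : Fin m → Fin m → ZMod N) (a b : Fin m) : ℂ :=
  ZMod.stdAddChar (q a b)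

section
variable {m N : ℕ} [NeZero N] {q : Fin m → Fin m → ZMod N}

theorem star_stdAddChar (x : ZMod N) :
    star (ZMod.stdAddChar x : ℂ) = ZMod.stdAddChar (-x) :=
  (AddChar.map_neg_eq_conj _ x).symm

theorem charPhase_mul_star (a b c e : Fin m) :
    charPhase q a b * star (charPhase q c e) = ZMod.stdAddChar (q a b - q c e) := by
  rw [charPhase, charPhase, star_stdAddChar, ← AddChar.map_add_eq_mul, sub_eq_add_neg]

theorem isLocalTL_charPhase [NeZero m]
    (hup : ∀ a b c t, t ≠ 0 → ∑ s, (ZMod.stdAddChar (-q (a + s) (b + s) + q (b + s) c +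
      -q (b + s + t) (c + t) + q (a + s) (b + s + t)) : ℂ) = 0)
    (hdown : ∀ a b c t, t ≠ 0 → ∑ s, (ZMod.stdAddChar (-q (b + s) (c + s) + q a (b + s) +
      -q (a + t) (b + s + t) + q (b + s + t) (c + s)) : ℂ) = 0) :
    IsLocalTL ((Real.sqrt m : ℝ) : ℂ) (phaseTL (charPhase q)) := by
  refine isLocalTL_phaseTL (fun a b => by rw [charPhase_mul_star, sub_self, AddChar.map_zero_eq_one])
    (fun a b c t ht => ?_) (fun a b c t ht => ?_)
  · rw [← hup a b c t ht]
    simp only [charPhase, star_stdAddChar, AddChar.map_add_eq_mul]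
  · rw [← hdown a b c t ht]
    simp only [charPhase, star_stdAddChar, AddChar.map_add_eq_mul]

end

theorem stdAddChar_four_two : (ZMod.stdAddChar (2 : ZMod 4) : ℂ) = -1 := by
  have h := ZMod.stdAddChar_coe (N := 4) 2
  push_cast at h
  rw [h, ← Complex.exp_pi_mul_I]
  congr 1; ring

theorem stdAddChar_four_one : (ZMod.stdAddChar (1 : ZMod 4) : ℂ) = Complex.I := by
  have h := ZMod.stdAddChar_coe (N := 4) 1
  push_cast at h
  rw [h]
  refine (congrArg Complex.exp ?_).trans Complex.exp_pi_div_two_mul_I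
  ring

theorem stdAddChar_three_one : (ZMod.stdAddChar (1 : ZMod 3) : ℂ) = cubeRoot := by
  have h := ZMod.stdAddChar_coe (N := 3) 1
  push_cast at h
  rw [h, cubeRoot]
  congr 1; ring

theorem stdAddChar_three (x : ZMod 3) : (ZMod.stdAddChar x : ℂ) = cubeRoot ^ x.val := by
  rw [← stdAddChar_three_one, ← AddChar.map_nsmul_eq_pow, nsmul_one, ZMod.natCast_zmod_val]

theorem sum_stdAddChar_two {E : Fin 2 → ZMod 4} (h : E 1 = E 0 + 2) :
    ∑ s, (ZMod.stdAddChar (E s) : ℂ) = 0 := by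
  rw [Fin.sum_univ_two, h, AddChar.map_add_eq_mul, stdAddChar_four_two]
  ring

theorem sum_stdAddChar_three {E : Fin 3 → ZMod 3} (h : Function.Injective E) :
    ∑ s, (ZMod.stdAddChar (E s) : ℂ) = 0 := by
  have hb : Function.Bijective E :=
    (Fintype.bijective_iff_injective_and_card E).2 ⟨h, by simp⟩
  rw [hb.sum_comp fun x => (ZMod.stdAddChar x : ℂ)]
  refine AddChar.sum_eq_zero_of_ne_one ?_
  have := ZMod.isPrimitive_stdAddChar 3 (a := 1) (by decide)
  simpa [AddChar.mulShift_one] using this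

/-- The phase exponents of the `4 × 4` solution. -/
def isingExponent : Fin 2 → Fin 2 → ZMod 4 := ![![0, 0], ![1, 3]]

/-- The phase exponents of the `9 × 9` solution. -/
def levelFourExponent : Fin 3 → Fin 3 → ZMod 3 := ![![0, 0, 0], ![0, 2, 1], ![2, 0, 1]]

/-- In each cancelling sum the two exponents differ by 2 modulo 4, so the terms are opposite; this
is a finite check. -/
theorem isLocalTL_ising :
    IsLocalTL ((Real.sqrt (2 : ℕ) : ℝ) : ℂ) (phaseTL (charPhase isingExponent)) :=
  isLocalTL_charPhase
    (fun a b c t ht => sum_stdAddChar_two (by revert a b c t; decide))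
    (fun a b c t ht => sum_stdAddChar_two (by revert a b c t; decide))

/-- The conjugate phases are also needed, since the same matrix `isingR` has to serve both values of
δ. -/
theorem isLocalTL_ising_neg :
    IsLocalTL ((Real.sqrt (2 : ℕ) : ℝ) : ℂ) (phaseTL (charPhase (-isingExponent))) :=
  isLocalTL_charPhase
    (fun a b c t ht => sum_stdAddChar_two (by revert a b c t; decide))
    (fun a b c t ht => sum_stdAddChar_two (by revert a b c t; decide))

set_option maxRecDepth 10000 in
-- In each cancelling sum the three exponents are distinct modulo 3, so all cube roots of unity
-- occur once.
theorem isLocalTL_levelFour :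
    IsLocalTL ((Real.sqrt (3 : ℕ) : ℝ) : ℂ) (phaseTL (charPhase levelFourExponent)) :=
  isLocalTL_charPhase
    (fun a b c t ht => sum_stdAddChar_three (by revert a b c t; decide))
    (fun a b c t ht => sum_stdAddChar_three (by revert a b c t; decide))

/-- The shift by 2 in the exponent comes from e^{-πi/6} = iω², the coefficient of U in
`levelFourR_eq`. In `ising_entry` the shift 3 plays the same role, contributing the factor -i. -/
theorem levelFour_entry (w : ℂ) (a b c e : Fin 3) :
    (!![w, 0, 0, 0, 1, 0, 0, 0, w;
        0, w, 0, 0, 0, w, 1, 0, 0;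
        0, 0, w, w ^ 2, 0, 0, 0, w ^ 2, 0;
        0, 0, w ^ 2, w, 0, 0, 0, w ^ 2, 0;
        w, 0, 0, 0, w, 0, 0, 0, 1;
        0, 1, 0, 0, 0, w, w, 0, 0;
        0, w, 0, 0, 0, 1, w, 0, 0;
        0, 0, w ^ 2, w ^ 2, 0, 0, 0, w, 0;
        1, 0, 0, 0, w, 0, 0, 0, w] : Matrix (Fin 9) (Fin 9) ℂ)
      (finProdFinEquiv (a, b)) (finProdFinEquiv (c, e)) =
    if a - b = c - e then if a = c then w else
      w ^ (levelFourExponent a b - levelFourExponent c e + 2).val else 0 := by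
  have h0 : w ^ (0 : ZMod 3).val = 1 := pow_zero w
  have h1 : w ^ (1 : ZMod 3).val = w := pow_one w
  have h2 : w ^ (2 : ZMod 3).val = w ^ 2 := rfl
  fin_cases a <;> fin_cases b <;> fin_cases c <;> fin_cases e <;>
    first
    | rfl
    | exact h0.symm
    | exact h1.symm

theorem ising_entry (a b c e : Fin 2) :
    (!![1, 0, 0, 1;
        0, 1, -1, 0;
        0, 1, 1, 0;
        -1, 0, 0, 1] : Matrix (Fin 4) (Fin 4) ℂ)
      (finProdFinEquiv (a, b)) (finProdFinEquiv (c, e)) =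
    if a - b = c - e then if a = c then 1 else
      ZMod.stdAddChar (isingExponent a b - isingExponent c e + 3) else 0 := by
  have h0 : (ZMod.stdAddChar (0 : ZMod 4) : ℂ) = 1 := AddChar.map_zero_eq_one _
  have h2 := stdAddChar_four_two
  fin_cases a <;> fin_cases b <;> fin_cases c <;> fin_cases e <;>
    first
    | rfl
    | exact h0.symm
    | exact h2.symm

/-! ### Explicit localizations at levels 1, 2 and 4 -/

section
variable {k : ℕ} {ε δ : ℤˣ}

theorem star_kauffmanVar : star ((kauffmanVar k ε δ : ℂˣ) : ℂ) =
    (((kauffmanVar k ε δ)⁻¹ : ℂˣ) : ℂ) := by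
  have h : ‖((kauffmanVar k ε δ : ℂˣ) : ℂ)‖ ^ 2 = 1 := by
    rw [← norm_pow, kauffmanVar_sq, norm_neg, ← Complex.ofReal_intCast, ← Complex.ofReal_mul,
      Complex.norm_exp_ofReal_mul_I]
  have h1 : ‖((kauffmanVar k ε δ : ℂˣ) : ℂ)‖ = 1 :=
    (pow_eq_one_iff_of_nonneg (norm_nonneg _) two_ne_zero).1 h
  rw [Units.val_inv_eq_inv_val, Complex.inv_eq_conj h1]
  rfl

theorem exists_localization_phaseTL {m : ℕ} [NeZero m] {α : Fin m → Fin m → ℂ}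
    (hα : ∀ a b, α a b * star (α a b) = 1)
    (hU : IsLocalTL ((Real.sqrt m : ℝ) : ℂ) (phaseTL α))
    (hd : 2 * Real.cos (Real.pi / (k + 2)) = Real.sqrt m) :
    ∃ W : UnitaryRMatrix m, W.R = ((kauffmanVar k ε δ : ℂˣ) : ℂ) • 1 +
      (((kauffmanVar k ε δ)⁻¹ : ℂˣ) : ℂ) • phaseTL α ∧
      IsLocalizedBy (jonesRep k (kauffmanVar k ε δ)) W := by
  have hloop : loopVar (kauffmanVar k ε δ) = ((Real.sqrt m : ℝ) : ℂ) := by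
    rw [loopVar_kauffmanVar, hd]
  rw [← hloop] at hU
  obtain ⟨W, hW⟩ := hU.exists_unitaryRMatrix star_phaseTL star_kauffmanVar
  refine ⟨W, hW, hU.isLocalizedBy (NeZero.ne m) ?_ ?_ (fun i hi => chebDelta_ne_zero hi) ?_ hW⟩
  · rw [hloop]; exact sqrt_natCast_ne_zero
  · rw [hloop]; exact trace_phaseTL hα
  · rw [chebDelta_kauffmanVar, levelDelta_succ_self, Complex.ofReal_zero]

/-- Here d = 2cos(π/3) = 1 = √1, so a one-dimensional space with trivial phases works. -/
theorem localizable_one : Localizable (jonesRep 1 (kauffmanVar 1 ε δ)) := by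
  obtain ⟨W, -, hW⟩ := exists_localization_phaseTL (k := 1) (ε := ε) (δ := δ) (m := 1)
    (α := fun _ _ => 1) (by simp)
    (isLocalTL_phaseTL (by simp) (fun _ _ _ t ht => absurd (Subsingleton.elim t 0) ht)
      (fun _ _ _ t ht => absurd (Subsingleton.elim t 0) ht))
    (by norm_num)
  exact ⟨1, W, hW⟩

theorem phaseTL_charPhase_apply {m N : ℕ} [NeZero N] {q : Fin m → Fin m → ZMod N}
    (f g : Fin 2 → Fin m) : phaseTL (charPhase q) f g = if f 0 - f 1 = g 0 - g 1 then
      ((Real.sqrt m : ℝ) : ℂ)⁻¹ * ZMod.stdAddChar (q (f 0) (f 1) - q (g 0) (g 1)) else 0 := by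
  rw [← charPhase_mul_star]
  rfl

theorem charPhase_mul_star_self {m N : ℕ} [NeZero N] {q : Fin m → Fin m → ZMod N} (a b : Fin m) :
    charPhase q a b * star (charPhase q a b) = 1 := by
  rw [charPhase_mul_star, sub_self, AddChar.map_zero_eq_one]

/-- An operator with constant diagonal that is proportional to a phase solution off the diagonal
is a combination of it and the identity. -/
theorem eq_one_add_phaseTL {m N : ℕ} [NeZero N] {q : Fin m → Fin m → ZMod N} {x y : ℂ}
    {R : Matrix (Fin 2 → Fin m) (Fin 2 → Fin m) ℂ}
    (hdiag : ∀ f, R f f = x + y * ((Real.sqrt m : ℝ) : ℂ)⁻¹)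
    (hoff : ∀ f g : Fin 2 → Fin m, f 0 - f 1 = g 0 - g 1 → f 0 ≠ g 0 → R f g =
      y * ((Real.sqrt m : ℝ) : ℂ)⁻¹ * ZMod.stdAddChar (q (f 0) (f 1) - q (g 0) (g 1)))
    (hzero : ∀ f g : Fin 2 → Fin m, f 0 - f 1 ≠ g 0 - g 1 → R f g = 0) :
    R = x • 1 + y • phaseTL (charPhase q) := by
  ext f g
  rw [Matrix.add_apply, Matrix.smul_apply, Matrix.smul_apply, phaseTL_charPhase_apply, smul_eq_mul,
    smul_eq_mul]
  by_cases h : f 0 - f 1 = g 0 - g 1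
  · rw [if_pos h]
    by_cases h0 : f 0 = g 0
    · have hfg : f = g := by
        funext i
        fin_cases i
        · exact h0
        · have : NeZero m := ⟨fun hm => (hm ▸ f 0).elim0⟩
          rw [h0] at h
          exact sub_right_injective h
      subst hfg
      rw [hdiag, Matrix.one_apply_eq, sub_self, AddChar.map_zero_eq_one]
      ring
    · rw [hoff f g h h0, Matrix.one_apply_ne fun hfg => h0 (congrFun hfg 0)]
      ring
  · rw [if_neg h, hzero f g h, Matrix.one_apply_ne fun hfg => h (by rw [hfg])]
    ring

theorem cubeRoot_eq : cubeRoot = -1 / 2 + ((Real.sqrt 3 : ℝ) : ℂ) / 2 * Complex.I := by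
  have h : cubeRoot = Complex.exp (((Real.pi / 3 : ℝ) : ℂ) * Complex.I) ^ 2 := by
    rw [cubeRoot, ← Complex.exp_nat_mul]
    congr 1
    push_cast
    ring
  have h3 := sqrt_natCast_sq 3
  rw [h, Complex.exp_mul_I, ← Complex.ofReal_cos, ← Complex.ofReal_sin, Real.cos_pi_div_three,
    Real.sin_pi_div_three]
  push_cast at h3 ⊢
  linear_combination (1 / 4) * Complex.I ^ 2 * h3 + (3 / 4) * Complex.I_sq

theorem exp_neg_pi_div_six : Complex.exp (-(((Real.pi / 6 : ℝ) : ℂ) * Complex.I)) =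
    Complex.I * cubeRoot ^ 2 := by
  have h : -(((Real.pi / 6 : ℝ) : ℂ) * Complex.I) = (Real.pi : ℂ) / 2 * Complex.I +
      (2 : ℕ) * (2 * (Real.pi : ℂ) * Complex.I / 3) - 2 * Real.pi * Complex.I := by
    push_cast
    ring
  rw [h, Complex.exp_sub, Complex.exp_two_pi_mul_I, div_one, Complex.exp_add,
    Complex.exp_pi_div_two_mul_I, Complex.exp_nat_mul, cubeRoot]

theorem levelFourR_eq : levelFourR =
    (-1 : ℂ) • 1 + Complex.exp (-(((Real.pi / 6 : ℝ) : ℂ) * Complex.I)) •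
      phaseTL (charPhase levelFourExponent) := by
  have h3 : ((Real.sqrt 3 : ℝ) : ℂ) * ((Real.sqrt 3 : ℝ) : ℂ) = 3 := by
    simpa using sqrt_natCast_sq 3
  have h0 : ((Real.sqrt 3 : ℝ) : ℂ) ≠ 0 := by simp
  rw [exp_neg_pi_div_six]
  have hR : ∀ f g : Fin 2 → Fin 3, levelFourR f g = Complex.I / ((Real.sqrt 3 : ℝ) : ℂ) *
      if f 0 - f 1 = g 0 - g 1 then if f 0 = g 0 then cubeRoot else
        cubeRoot ^ (levelFourExponent (f 0) (f 1) - levelFourExponent (g 0) (g 1) + 2).val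
      else 0 := by
    intro f g
    rw [← levelFour_entry]
    rfl
  refine eq_one_add_phaseTL (fun f => ?_) (fun f g h h' => ?_) (fun f g h => ?_)
  · rw [hR, if_pos rfl, if_pos rfl]
    have key : Complex.I * cubeRoot = -((Real.sqrt 3 : ℝ) : ℂ) + Complex.I * cubeRoot ^ 2 := by
      rw [cubeRoot_eq]
      linear_combination (((Real.sqrt 3 : ℝ) : ℂ) - ((Real.sqrt 3 : ℝ) : ℂ) ^ 2 * Complex.I / 4) *
        Complex.I_sq + (Complex.I / 4) * h3
    push_cast
    field_simp
    linear_combination key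
  · rw [hR, if_pos h, if_neg h', ← stdAddChar_three, AddChar.map_add_eq_mul, stdAddChar_three 2]
    have : (2 : ZMod 3).val = 2 := rfl
    rw [this]
    push_cast
    ring
  · rw [hR, if_neg h, mul_zero]

theorem isingR_entry (f g : Fin 2 → Fin 2) : isingR f g =
    -Complex.exp (-((Real.pi : ℂ) * Complex.I / 4)) / ((Real.sqrt 2 : ℝ) : ℂ) *
      if f 0 - f 1 = g 0 - g 1 then if f 0 = g 0 then 1 else
        ZMod.stdAddChar (isingExponent (f 0) (f 1) - isingExponent (g 0) (g 1) + 3) else 0 := by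
  rw [← ising_entry]
  rfl

theorem exp_neg_pi_div_four : Complex.exp (-((Real.pi : ℂ) * Complex.I / 4)) =
    ((Real.sqrt 2 : ℝ) : ℂ) / 2 * (1 - Complex.I) := by
  have : -((Real.pi : ℂ) * Complex.I / 4) = ((-(Real.pi / 4) : ℝ) : ℂ) * Complex.I := by
    push_cast; ring
  rw [this, Complex.exp_mul_I, ← Complex.ofReal_cos, ← Complex.ofReal_sin, Real.cos_neg,
    Real.sin_neg, Real.cos_pi_div_four, Real.sin_pi_div_four]
  push_cast
  ring

theorem exp_pi_div_four : Complex.exp ((Real.pi : ℂ) * Complex.I / 4) =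
    ((Real.sqrt 2 : ℝ) : ℂ) / 2 * (1 + Complex.I) := by
  have : (Real.pi : ℂ) * Complex.I / 4 = ((Real.pi / 4 : ℝ) : ℂ) * Complex.I := by
    push_cast; ring
  rw [this, Complex.exp_mul_I, ← Complex.ofReal_cos, ← Complex.ofReal_sin,
    Real.cos_pi_div_four, Real.sin_pi_div_four]
  push_cast
  ring

theorem stdAddChar_four_three : (ZMod.stdAddChar (3 : ZMod 4) : ℂ) = -Complex.I := by
  have : (3 : ZMod 4) = 2 + 1 := rfl
  rw [this, AddChar.map_add_eq_mul, stdAddChar_four_two, stdAddChar_four_one, neg_one_mul]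

theorem isingR_eq : isingR = (-1 : ℂ) • 1 + Complex.exp ((Real.pi : ℂ) * Complex.I / 4) •
    phaseTL (charPhase isingExponent) := by
  have h0 : ((Real.sqrt 2 : ℝ) : ℂ) ≠ 0 := by simp
  rw [exp_pi_div_four]
  refine eq_one_add_phaseTL (fun f => ?_) (fun f g h h' => ?_) (fun f g h => ?_)
  · rw [isingR_entry, if_pos rfl, if_pos rfl, exp_neg_pi_div_four]
    push_cast
    field_simp
    ring
  · rw [isingR_entry, if_pos h, if_neg h', AddChar.map_add_eq_mul, stdAddChar_four_three,
      exp_neg_pi_div_four]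
    push_cast
    field_simp
    linear_combination -(ZMod.stdAddChar (isingExponent (f 0) (f 1) -
      isingExponent (g 0) (g 1)) : ℂ) * Complex.I_sq
  · rw [isingR_entry, if_neg h, mul_zero]

/-- `isingR` has eigenvalues i and -1; the phase solutions for `isingExponent` and its negative are
√2 times the projections onto the two eigenspaces. This expansion is therefore `isingR_eq` with the
eigenspaces exchanged. -/
theorem isingR_eq_neg : isingR = Complex.I • 1 +
    (-Complex.I * Complex.exp (-((Real.pi : ℂ) * Complex.I / 4))) •
      phaseTL (charPhase (-isingExponent)) := by
  have h0 : ((Real.sqrt 2 : ℝ) : ℂ) ≠ 0 := by simp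
  refine eq_one_add_phaseTL (fun f => ?_) (fun f g h h' => ?_) (fun f g h => ?_)
  · rw [isingR_entry, if_pos rfl, if_pos rfl, exp_neg_pi_div_four]
    push_cast
    field_simp
    linear_combination (-1 : ℂ) * Complex.I_sq
  · have hx : ∀ a b c e : Fin 2, a - b = c - e → a ≠ c →
        (-isingExponent) a b - (-isingExponent) c e =
          isingExponent a b - isingExponent c e + 2 := by decide
    rw [isingR_entry, if_pos h, if_neg h', hx _ _ _ _ h h', AddChar.map_add_eq_mul,
      AddChar.map_add_eq_mul, stdAddChar_four_three, stdAddChar_four_two]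
    push_cast
    ring
  · rw [isingR_entry, if_neg h, mul_zero]

theorem exists_ising_localization : ∃ (c : ℂ) (W : UnitaryRMatrix 2), W.R = c • isingR ∧
    IsLocalizedBy (jonesRep 2 (kauffmanVar 2 ε δ)) W := by
  have hd : 2 * Real.cos (Real.pi / ((2 : ℕ) + 2)) = Real.sqrt (2 : ℕ) := by
    have : Real.pi / ((2 : ℕ) + 2) = Real.pi / 4 := by norm_num
    rw [this, Real.cos_pi_div_four]
    push_cast; ring
  have hA2 := kauffmanVar_sq 2 ε δ
  rcases Int.units_eq_one_or δ with rfl | rfl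
  · obtain ⟨W, hW, h⟩ := exists_localization_phaseTL (k := 2) (ε := ε) (δ := 1)
      charPhase_mul_star_self isLocalTL_ising_neg hd
    -- The scalar matches the coefficient i of the identity; the coefficient of U then agrees
    -- because A² = -e^{πi/4}.
    refine ⟨-Complex.I * kauffmanVar 2 ε 1, W, ?_, h⟩
    have he : Complex.exp ((Real.pi : ℂ) * Complex.I / 4) *
        Complex.exp (-((Real.pi : ℂ) * Complex.I / 4)) = 1 := by
      rw [← Complex.exp_add, add_neg_cancel, Complex.exp_zero]
    have hx : (((1 : ℤˣ) : ℤ) : ℂ) * ((Real.pi / ((2 : ℕ) + 2) : ℝ) : ℂ) * Complex.I =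
        (Real.pi : ℂ) * Complex.I / 4 := by
      push_cast; ring
    rw [hx] at hA2
    rw [hW, isingR_eq_neg, smul_add, smul_smul, smul_smul]
    congr 2
    · linear_combination (((kauffmanVar 2 ε 1 : ℂˣ) : ℂ)) * Complex.I_sq
    · rw [Units.val_inv_eq_inv_val]
      refine (eq_inv_of_mul_eq_one_left ?_).symm
      linear_combination ((kauffmanVar 2 ε 1 : ℂˣ) : ℂ) ^ 2 *
        Complex.exp (-((Real.pi : ℂ) * Complex.I / 4)) * Complex.I_sq -
        Complex.exp (-((Real.pi : ℂ) * Complex.I / 4)) * hA2 + he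
  · obtain ⟨W, hW, h⟩ := exists_localization_phaseTL (k := 2) (ε := ε) (δ := -1)
      charPhase_mul_star_self isLocalTL_ising hd
    refine ⟨-kauffmanVar 2 ε (-1), W, ?_, h⟩
    have he : Complex.exp (-((Real.pi : ℂ) * Complex.I / 4)) *
        Complex.exp ((Real.pi : ℂ) * Complex.I / 4) = 1 := by
      rw [← Complex.exp_add, neg_add_cancel, Complex.exp_zero]
    have hx : (((-1 : ℤˣ) : ℤ) : ℂ) * ((Real.pi / ((2 : ℕ) + 2) : ℝ) : ℂ) * Complex.I =
        -((Real.pi : ℂ) * Complex.I / 4) := by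
      push_cast; ring
    rw [hx] at hA2
    rw [hW, isingR_eq, smul_add, smul_smul, smul_smul]
    congr 2
    · ring
    · rw [Units.val_inv_eq_inv_val]
      refine (eq_inv_of_mul_eq_one_left ?_).symm
      linear_combination -Complex.exp ((Real.pi : ℂ) * Complex.I / 4) * hA2 + he

theorem conjTranspose_levelFourR_eq : levelFourRᴴ =
    (-1 : ℂ) • 1 + Complex.exp (((Real.pi / 6 : ℝ) : ℂ) * Complex.I) •
      phaseTL (charPhase levelFourExponent) := by
  have h : star (Complex.exp (-(((Real.pi / 6 : ℝ) : ℂ) * Complex.I))) =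
      Complex.exp (((Real.pi / 6 : ℝ) : ℂ) * Complex.I) := by
    rw [← starRingEnd_apply, ← Complex.exp_conj, map_neg, map_mul, Complex.conj_ofReal,
      Complex.conj_I, mul_neg, neg_neg]
  rw [levelFourR_eq, ← Matrix.star_eq_conjTranspose, star_add, star_smul, star_smul, star_phaseTL,
    h, star_one, star_neg, star_one]

/-- A + A⁻¹U = -A(-1 - A⁻²U) with -A⁻² = e^{-δπi/6}. Since U is Hermitian, changing δ amounts to
taking the adjoint of the bracket. -/
theorem exists_levelFour_localization : ∃ (c : ℂ) (W : UnitaryRMatrix 3),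
    W.R = c • (if δ = 1 then levelFourR else levelFourRᴴ) ∧
    IsLocalizedBy (jonesRep 4 (kauffmanVar 4 ε δ)) W := by
  have hd : 2 * Real.cos (Real.pi / ((4 : ℕ) + 2)) = Real.sqrt (3 : ℕ) := by
    have : Real.pi / ((4 : ℕ) + 2) = Real.pi / 6 := by norm_num
    rw [this, Real.cos_pi_div_six]
    push_cast; ring
  have hA2 := kauffmanVar_sq 4 ε δ
  obtain ⟨W, hW, h⟩ := exists_localization_phaseTL (k := 4) (ε := ε) (δ := δ)
      charPhase_mul_star_self isLocalTL_levelFour hd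
  refine ⟨-kauffmanVar 4 ε δ, W, ?_, h⟩
  have he : Complex.exp (((Real.pi / 6 : ℝ) : ℂ) * Complex.I) *
      Complex.exp (-(((Real.pi / 6 : ℝ) : ℂ) * Complex.I)) = 1 := by
    rw [← Complex.exp_add, add_neg_cancel, Complex.exp_zero]
  rcases Int.units_eq_one_or δ with rfl | rfl
  · have hx : (((1 : ℤˣ) : ℤ) : ℂ) * ((Real.pi / ((4 : ℕ) + 2) : ℝ) : ℂ) * Complex.I =
        ((Real.pi / 6 : ℝ) : ℂ) * Complex.I := by
      push_cast; ring
    rw [hx] at hA2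
    rw [hW, if_pos rfl, levelFourR_eq, smul_add, smul_smul, smul_smul]
    congr 2
    · ring
    · rw [Units.val_inv_eq_inv_val]
      refine (eq_inv_of_mul_eq_one_left ?_).symm
      linear_combination -Complex.exp (-(((Real.pi / 6 : ℝ) : ℂ) * Complex.I)) * hA2 + he
  · have hx : (((-1 : ℤˣ) : ℤ) : ℂ) * ((Real.pi / ((4 : ℕ) + 2) : ℝ) : ℂ) * Complex.I =
        -(((Real.pi / 6 : ℝ) : ℂ) * Complex.I) := by
      push_cast; ring
    rw [hx] at hA2
    rw [hW, if_neg (by decide), conjTranspose_levelFourR_eq, smul_add, smul_smul, smul_smul]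
    congr 2
    · ring
    · rw [Units.val_inv_eq_inv_val]
      refine (eq_inv_of_mul_eq_one_left ?_).symm
      linear_combination -Complex.exp (((Real.pi / 6 : ℝ) : ℂ) * Complex.I) * hA2 + he

end

theorem theorem6 (k : ℕ) (hk : 1 ≤ k) (ε δ : ℤˣ) :
    (Localizable (jonesRep k (kauffmanVar k ε δ)) ↔ k ∈ ({1, 2, 4} : Set ℕ)) ∧
    (k = 2 → ∃ (c : ℂ) (W : UnitaryRMatrix 2), W.R = c • isingR ∧
      IsLocalizedBy (jonesRep k (kauffmanVar k ε δ)) W) ∧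
    (k = 4 → ∃ (c : ℂ) (W : UnitaryRMatrix 3),
      W.R = c • (if δ = 1 then levelFourR else levelFourRᴴ) ∧
      IsLocalizedBy (jonesRep k (kauffmanVar k ε δ)) W) := by
  refine ⟨⟨level_of_localizable hk, ?_⟩, ?_, ?_⟩
  · rintro (rfl | rfl | rfl)
    · exact localizable_one
    · obtain ⟨_, W, -, h⟩ := exists_ising_localization (ε := ε) (δ := δ)
      exact ⟨2, W, h⟩
    · obtain ⟨_, W, -, h⟩ := exists_levelFour_localization (ε := ε) (δ := δ)
      exact ⟨3, W, h⟩
  · rintro rfl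
    exact exists_ising_localization
  · rintro rfl
    exact exists_levelFour_localization
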